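/- A Carnot group is a simply connected Lie group $\mathbb{G}$ whose Lie algebra has a stratification $\mathfrak{g}=V_1\oplus\cdots\oplus V_s$ with $V_i=[V_1,V_{i-1}]$ for $2\le i\le s$ and $[V_1,V_s]=0$; $V_1$ is the horizontal layer. Given a basis $X_1,\dots,X_r$ of $V_1$, regarded as left invariant vector fields, an absolutely continuous curve $\gamma\colon[a,b]\to\mathbb{G}$ is horizontal if there are $u_1,\dots,u_r\in L^1[a,b]$ with $\gamma'(t)=\sum_j u_j(t)X_j(\gamma(t))$ for almost every $t$; its length is $\int_a^b|u|$ ($|\cdot|$ the Euclidean norm on $\mathbb{R}^r$), and the CC distance $d(x,y)$ induced by the basis is the infimum of the lengths of the horizontal curves joining $x$ to $y$. Write $d(x)=d(x,e)$, with $e$ the identity. The dilations are $\delta_\lambda\big(\exp(v_1+\cdots+v_s)\big)=\exp(\lambda v_1+\cdots+\lambda^s v_s)$ for $v_i\in V_i$ and $\lambda>0$. A function $L\colon\mathbb{G}\to\mathbb{R}$ is $\mathbb{G}$-linear if $L(xy)=L(x)+L(y)$ and $L(\delta_\lambda(x))=\lambda L(x)$ for all $x,y\in\mathbb{G}$ and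 $\lambda>0$. A function $f\colon\mathbb{G}\to\mathbb{R}$ is Pansu differentiable at $x$ if there is a $\mathbb{G}$-linear $L$ with $|f(y)-f(x)-L(x^{-1}y)|/d(x,y)\to 0$ as $y\to x$ in $(\mathbb{G},d)$. The CC distance of $\mathbb{G}$ is differentiable in horizontal directions if $x\mapsto d(x)$ is Pansu differentiable at every point $\exp E$ with $E\in V_1\setminus\{0\}$. Proposition. Let $\mathbb{G}$ and $\mathbb{H}$ be Carnot groups with horizontal layers $V$ and $W$, let $X_1,\dots,X_r$ be a basis of $V$ and $Y_1,\dots,Y_r$ a basis of $W$, and equip $\mathbb{G}$ and $\mathbb{H}$ with the CC distances induced by these bases. Let $F\colon\mathbb{G}\to\mathbb{H}$ be a Lie group homomorphism with $F_*(X_i)=Y_i$ for $1\le i\le r$. If the CC distance of $\mathbb{G}$ is differentiable in horizontal directions, then the CC distance of $\mathbb{H}$ is differentiable in horizontal directions. -/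

import Mathlib

open Set MeasureTheory
open scoped Manifold ContDiff ENNReal

/-- A stratification of step `s` of the Lie algebra `𝔤` of the Lie group `G`:
`𝔤 = V₁ ⊕ ⋯ ⊕ V_s`, `V_{i+1} = [V₁, V_i]` for `1 ≤ i < s` and `[V₁, V_s] = 0`.
The layers are indexed by `ℕ`, with `V_i = 0` for `i = 0` and for `i > s`, so that the last two
conditions are the single field `layer_succ`. A Carnot group is a simply connected Lie group
together with such a stratification. -/
structure CarnotStratification {n : ℕ} (G : Type*) [TopologicalSpace G]
    [ChartedSpace (EuclideanSpace ℝ (Fin n)) G] [Group G] (s : ℕ) where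
  /-- the layers `V_i` -/
  layer : ℕ → Submodule ℝ (GroupLieAlgebra (𝓡 n) G)
  layer_zero : layer 0 = ⊥
  layer_eq_bot : ∀ i, s < i → layer i = ⊥
  isInternal : DirectSum.IsInternal layer
  layer_succ : ∀ i, 1 ≤ i →
    layer (i + 1) = Submodule.span ℝ {z | ∃ x ∈ layer 1, ∃ y ∈ layer i, z = ⁅x, y⁆}

section CarnotGroup

variable {n : ℕ} {G : Type*} [TopologicalSpace G] [ChartedSpace (EuclideanSpace ℝ (Fin n)) G]
  [Group G]

/-- `IsLieExp v g` means `g = exp v`: the point `g` is the value at time one of the integral curve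
(defined on all of `ℝ`) through the identity of the left invariant vector field defined by `v`. -/
def IsLieExp (v : GroupLieAlgebra (𝓡 n) G) (g : G) : Prop :=
  ∃ γ : ℝ → G, γ 0 = 1 ∧ IsMIntegralCurve (I := 𝓡 n) γ (mulInvariantVectorField v) ∧ γ 1 = g

/-- `S.IsDilation c x y` means `y = δ_c x`: if `x = exp (∑ vᵢ)` with `vᵢ` in the `i`-th layer,
then `y = exp (∑ cⁱ vᵢ)`. -/
def CarnotStratification.IsDilation {s : ℕ} (S : CarnotStratification (n := n) G s)
    (c : ℝ) (x y : G) : Prop :=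
  ∃ v : ℕ → GroupLieAlgebra (𝓡 n) G, (∀ i, v i ∈ S.layer i) ∧
    IsLieExp (∑ i ∈ Finset.range (s + 1), v i) x ∧
    IsLieExp (∑ i ∈ Finset.range (s + 1), c ^ i • v i) y

/-- A function `L : G → ℝ` is `G`-linear if `L (x y) = L x + L y` and `L (δ_c x) = c L x` for
all `x, y` and all `c > 0`. -/
def CarnotStratification.IsGLinear {s : ℕ} (S : CarnotStratification (n := n) G s)
    (L : G → ℝ) : Prop :=
  (∀ x y, L (x * y) = L x + L y) ∧
    ∀ c : ℝ, 0 < c → ∀ x y, S.IsDilation c x y → L y = c * L x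

/-- The restriction to `[a, b]` of `γ` is an absolutely continuous curve in the manifold `G`:
it is continuous and every smooth real function is absolutely continuous along it (equivalently,
its coordinates in a global chart, or locally in charts, are absolutely continuous). -/
def IsACCurve (n : ℕ) {G : Type*} [TopologicalSpace G]
    [ChartedSpace (EuclideanSpace ℝ (Fin n)) G] (γ : ℝ → G) (a b : ℝ) : Prop :=
  ContinuousOn γ (Icc a b) ∧
    ∀ f : G → ℝ, ContMDiff (𝓡 n) 𝓘(ℝ) ∞ f → AbsolutelyContinuousOnInterval (f ∘ γ) a b

/-- With respect to the elements `X₁, …, X_r` of the Lie algebra, seen as left invariant vector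
fields, the curve `γ : [a, b] → G` is horizontal with controls `u = (u₁, …, u_r)`: it is absolutely
continuous, the `u_j` are in `L¹[a, b]`, and `γ' t = ∑ j, u_j t • X_j (γ t)` for almost every `t`
in `[a, b]`. -/
def IsHorizontalCurve {r : ℕ} (X : Fin r → GroupLieAlgebra (𝓡 n) G) (a b : ℝ) (γ : ℝ → G)
    (u : ℝ → EuclideanSpace ℝ (Fin r)) : Prop :=
  IsACCurve n γ a b ∧ IntegrableOn u (Icc a b) ∧
    ∀ᵐ t ∂(volume.restrict (Icc a b)),
      HasMFDerivAt 𝓘(ℝ) (𝓡 n) γ t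
        ((1 : ℝ →L[ℝ] ℝ).smulRight (∑ j, u t j • mulInvariantVectorField (X j) (γ t)))

/-- The Carnot–Carathéodory distance with values in `[0, ∞]`: the infimum of the lengths
`∫ |u|` of the horizontal curves joining `x` to `y`. -/
noncomputable def ccEDist {r : ℕ} (X : Fin r → GroupLieAlgebra (𝓡 n) G) (x y : G) : ℝ≥0∞ :=
  sInf {ℓ | ∃ (a b : ℝ) (γ : ℝ → G) (u : ℝ → EuclideanSpace ℝ (Fin r)), a ≤ b ∧
    IsHorizontalCurve X a b γ u ∧ γ a = x ∧ γ b = y ∧ ℓ = ENNReal.ofReal (∫ t in a..b, ‖u t‖)}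

/-- The Carnot–Carathéodory distance as a real number (in a Carnot group, with `X` a basis of the
first layer, the infimum above is always finite). -/
noncomputable def ccDist {r : ℕ} (X : Fin r → GroupLieAlgebra (𝓡 n) G) (x y : G) : ℝ :=
  (ccEDist X x y).toReal

namespace CarnotStratification

variable {s r : ℕ} (S : CarnotStratification (n := n) G s)

/-- The elements of a basis of the horizontal layer, as elements of the Lie algebra. -/
noncomputable def frame (X : Module.Basis (Fin r) ℝ (S.layer 1)) (j : Fin r) : GroupLieAlgebra (𝓡 n) G :=
  (X j : GroupLieAlgebra (𝓡 n) G)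

/-- `f : G → ℝ` is Pansu differentiable at `x`: there is a `G`-linear `L` such that
`|f y - f x - L (x⁻¹ y)| / d(x, y)` tends to `0` as `y → x` in the metric space `(G, d)`,
where `d` is the Carnot–Carathéodory distance of the basis `X` of the horizontal layer. -/
def PansuDifferentiableAt (X : Module.Basis (Fin r) ℝ (S.layer 1)) (f : G → ℝ) (x : G) : Prop :=
  ∃ L : G → ℝ, S.IsGLinear L ∧
    ∀ ε : ℝ, 0 < ε → ∃ δ : ℝ, 0 < δ ∧ ∀ y : G, ccEDist (S.frame X) x y < ENNReal.ofReal δ →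
      |f y - f x - L (x⁻¹ * y)| ≤ ε * ccDist (S.frame X) x y

/-- The Carnot–Carathéodory distance is differentiable in horizontal directions: the function
`x ↦ d(x, 1)` is Pansu differentiable at every point `exp E` with `E` a nonzero element of the
horizontal layer. -/
def CCDistDifferentiableHorizontally (X : Module.Basis (Fin r) ℝ (S.layer 1)) : Prop :=
  ∀ E ∈ S.layer 1, E ≠ 0 → ∀ u : G, IsLieExp E u →
    S.PansuDifferentiableAt X (fun x => ccDist (S.frame X) x 1) u

end CarnotStratification

end CarnotGroup

/-! Let `u = exp E` in `H`, let `c` be the coordinates of `E` in the basis `Y`, and let `L` be the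
`H`-linear function with horizontal derivative `e = c / |c|`. By Cauchy–Schwarz `L` is 1-Lipschitz,
so `L ≤ d` near `u`, while `L u = |c| = d(u)`. Hence `d(y) - d(u) ≥ L (u⁻¹ y)`: half of
differentiability, with differential `L`, is free in any Carnot group.

For the other half, let `u' = exp E'` in `G` have the same coordinates `c`, so that `F u' = u`.
Solving for a curve in `G` with the controls of a given curve in `H` lifts `y` near `u` to `z` with
`F z = y` and `d(u', z)` as close as desired to `d(u, y)`. Since `F` does not increase distances,
`d(y) ≤ d(z) ≤ |c| + P (u'⁻¹ z) + (ε/2) d(u', z)`, where `P` is the differential of the distance of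
`G` at `u'`. The calibration `L ∘ F` bounds `P`: at the reflected point `u' (u'⁻¹ z)⁻¹`, equally far
from `u'`, the free lower bound and differentiability give `P (u'⁻¹ z) ≤ L (u⁻¹ y) + (ε/2) d(u',
z)`. Adding up gives the missing inequality.

Two tools carry this. Lifting needs existence and uniqueness for `γ' = ∑ u_j X_j(γ)` with merely
integrable controls (`exists_isHorizontalCurve`, `IsHorizontalCurve.eqOn`, combined in
`exists_lift_ccEDist`). The calibration needs `exists_isGLinear`: a linear form killing all layers
but the first kills brackets, so it defines a closed left invariant 1-form, whose primitive on a
simply connected group is a homomorphism. Finiteness of the distance is only needed at points near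
`u` or `u'`, where the triangle inequality provides it. -/

open Filter Topology Metric
open scoped NNReal

/-! ### Absolutely continuous functions on an interval -/

section AbsolutelyContinuous

theorem AbsolutelyContinuousOnInterval.of_dist_le {X Y : Type*} [PseudoMetricSpace X]
    [PseudoMetricSpace Y] {h : ℝ → X} {g : ℝ → Y} {a b C : ℝ}
    (hg : AbsolutelyContinuousOnInterval g a b)
    (H : ∀ s ∈ uIcc a b, ∀ t ∈ uIcc a b, dist (h s) (h t) ≤ C * dist (g s) (g t)) :
    AbsolutelyContinuousOnInterval h a b := by
  unfold AbsolutelyContinuousOnInterval at *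
  refine squeeze_zero' (Eventually.of_forall fun E ↦ Finset.sum_nonneg fun i _ ↦ dist_nonneg) ?_
    (by simpa using hg.const_mul C)
  -- Only the part of the filter that puts all endpoints in `uIcc a b` matters for the domination.
  refine mem_inf_of_right ?_
  intro E hE
  simp only [mem_ofPred_eq, Finset.mul_sum]
  exact Finset.sum_le_sum fun i hi ↦ H _ (hE.1 i hi).1 _ (hE.1 i hi).2

theorem AbsolutelyContinuousOnInterval.congr_on {X : Type*} [PseudoMetricSpace X]
    {h g : ℝ → X} {a b : ℝ} (hg : AbsolutelyContinuousOnInterval g a b)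
    (H : EqOn h g (uIcc a b)) : AbsolutelyContinuousOnInterval h a b :=
  hg.of_dist_le (C := 1) fun s hs t ht ↦ by rw [H hs, H ht, one_mul]

theorem AbsolutelyContinuousOnInterval.eq_add_integral {h : ℝ → ℝ} {a b c t : ℝ}
    (hh : AbsolutelyContinuousOnInterval h a b) (hc : c ∈ uIcc a b) (ht : t ∈ uIcc a b) :
    h t = h c + ∫ s in c..t, deriv h s := by
  rw [(hh.mono (uIcc_subset_uIcc hc ht)).integral_deriv_eq_sub]
  ring

theorem absolutelyContinuousOnInterval_of_eq_add_integral {h g : ℝ → ℝ} {a b c k : ℝ}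
    (hc : c ∈ uIcc a b) (hg : IntervalIntegrable g volume a b)
    (H : ∀ t ∈ uIcc a b, h t = k + ∫ s in c..t, g s) : AbsolutelyContinuousOnInterval h a b := by
  refine (hg.absolutelyContinuousOnInterval_intervalIntegral hc).of_dist_le (C := 1) ?_
  intro s hs t ht
  rw [H s hs, H t ht, one_mul, dist_add_left]

/-- With the junction `b` as base point, both halves are given by the same formula `h b + ∫ deriv
h`, so no interval straddling `b` has to be cut. -/
theorem AbsolutelyContinuousOnInterval.trans {h : ℝ → ℝ} {a b c : ℝ} (hab : a ≤ b) (hbc : b ≤ c)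
    (h₁ : AbsolutelyContinuousOnInterval h a b) (h₂ : AbsolutelyContinuousOnInterval h b c) :
    AbsolutelyContinuousOnInterval h a c := by
  refine absolutelyContinuousOnInterval_of_eq_add_integral (c := b) (k := h b)
    (by rw [uIcc_of_le (hab.trans hbc)]; exact ⟨hab, hbc⟩)
    (h₁.intervalIntegrable_deriv.trans h₂.intervalIntegrable_deriv) ?_
  intro t ht
  rw [uIcc_of_le (hab.trans hbc)] at ht
  rcases le_total t b with htb | htb
  · exact h₁.eq_add_integral (by simp) (by rw [uIcc_of_le hab]; exact ⟨ht.1, htb⟩)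
  · exact h₂.eq_add_integral (by simp) (by rw [uIcc_of_le hbc]; exact ⟨htb, ht.2⟩)

theorem AbsolutelyContinuousOnInterval.comp_mul_add {h : ℝ → ℝ} {a b σ τ : ℝ} (hσ : σ ≠ 0)
    (hh : AbsolutelyContinuousOnInterval h (σ * a + τ) (σ * b + τ)) :
    AbsolutelyContinuousOnInterval (fun t ↦ h (σ * t + τ)) a b := by
  have hI : IntervalIntegrable (fun t ↦ deriv h (σ * t + τ)) volume a b := by
    have := (hh.intervalIntegrable_deriv.comp_add_right τ)
    simp only [add_sub_cancel_right] at this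
    have := this.comp_mul_left (c := σ)
    simpa [mul_div_cancel_left₀, hσ] using this
  refine absolutelyContinuousOnInterval_of_eq_add_integral (c := a) (k := h (σ * a + τ))
    (by simp) (hI.const_mul σ) ?_
  intro t ht
  have ht' : σ * t + τ ∈ uIcc (σ * a + τ) (σ * b + τ) := by
    have : (fun x ↦ σ * x + τ) '' uIcc a b = uIcc (σ * a + τ) (σ * b + τ) := by
      rw [show (fun x ↦ σ * x + τ) = (fun x ↦ x + τ) ∘ (fun x ↦ σ * x) from rfl, image_comp]
      simp
    rw [← this]
    exact ⟨t, ht, rfl⟩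
  rw [hh.eq_add_integral (c := σ * a + τ) (by simp) ht', intervalIntegral.integral_const_mul,
    intervalIntegral.mul_integral_comp_mul_add]

end AbsolutelyContinuous

/-! ### Carathéodory equations with integrable controls -/

section Caratheodory

variable {E U : Type*} [NormedAddCommGroup E] [NormedSpace ℝ E]
  [NormedAddCommGroup U] [NormedSpace ℝ U]

theorem integrableOn_clm_apply {A : ℝ → U →L[ℝ] E} {w : ℝ → U} {a b C : ℝ}
    (hA : ContinuousOn A (Icc a b)) (hC : ∀ t ∈ Icc a b, ‖A t‖ ≤ C)
    (hw : IntegrableOn w (Icc a b)) : IntegrableOn (fun t ↦ A t (w t)) (Icc a b) := by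
  have hm : AEStronglyMeasurable A (volume.restrict (Icc a b)) :=
    hA.aestronglyMeasurable measurableSet_Icc
  refine Integrable.mono' (hw.norm.const_mul C)
    (isBoundedBilinearMap_apply.continuous.comp_aestronglyMeasurable
      (hm.prodMk hw.aestronglyMeasurable)) ?_
  filter_upwards [ae_restrict_mem measurableSet_Icc] with t ht
  exact ((A t).le_opNorm _).trans (by gcongr; exact hC t ht)

theorem intervalIntegrable_of_mem_Icc {U : Type*} [NormedAddCommGroup U] {w : ℝ → U} {a b s t : ℝ}
    (hw : IntegrableOn w (Icc a b)) (hs : s ∈ Icc a b) (ht : t ∈ Icc a b) :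
    IntervalIntegrable w volume s t :=
  (hw.mono_set (uIcc_subset_Icc hs ht)).intervalIntegrable

/-- Local existence for the controlled differential equation `η' = A(η) w` with an integrable
control `w`. -/
theorem exists_eq_integral_of_lipschitzOnWith [CompleteSpace E] {A : E → U →L[ℝ] E} {x₀ : E} {ρ C : ℝ} {K : ℝ≥0}
    {a b : ℝ} {w : ℝ → U} (hab : a ≤ b) (hρ : 0 ≤ ρ) (hA : LipschitzOnWith K A (closedBall x₀ ρ))
    (hC : ∀ y ∈ closedBall x₀ ρ, ‖A y‖ ≤ C) (hw : IntegrableOn w (Icc a b))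
    (hCw : C * ∫ t in a..b, ‖w t‖ ≤ ρ) (hKw : K * ∫ t in a..b, ‖w t‖ < 1) :
    ∃ η : ℝ → E, ContinuousOn η (Icc a b) ∧ (∀ t ∈ Icc a b, η t ∈ closedBall x₀ ρ) ∧
      ∀ t ∈ Icc a b, η t = x₀ + ∫ s in a..t, A (η s) (w s) := by
  have hC0 : 0 ≤ C := (norm_nonneg _).trans (hC x₀ (by simpa using hρ))
  have ha : a ∈ Icc a b := left_mem_Icc.2 hab
  have hnw : IntegrableOn (fun t ↦ ‖w t‖) (Icc a b) := hw.norm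
  have hmono : ∀ t ∈ Icc a b, ∫ s in a..t, ‖w s‖ ≤ ∫ s in a..b, ‖w s‖ := fun t ht ↦
    intervalIntegral.integral_mono_interval le_rfl ht.1 ht.2
      (Eventually.of_forall fun _ ↦ norm_nonneg _)
      (intervalIntegrable_of_mem_Icc hnw ha (right_mem_Icc.2 hab))
  -- Banach fixed point for the Picard operator on curves in the closed ball: `hCw` keeps the curves
  -- in the ball and `hKw` makes the operator contracting for the sup distance.
  let Z := C(Icc a b, closedBall x₀ ρ)
  let ext : Z → ℝ → E := fun c t ↦ c (projIcc a b hab t)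
  have hext : ∀ c : Z, Continuous (ext c) := fun c ↦
    continuous_subtype_val.comp (c.continuous.comp continuous_projIcc)
  have hmem : ∀ c : Z, ∀ t, ext c t ∈ closedBall x₀ ρ := fun c t ↦ (c _).2
  have hAc : ∀ c : Z, ContinuousOn (fun t ↦ A (ext c t)) (Icc a b) := fun c ↦
    hA.continuousOn.comp (hext c).continuousOn fun t _ ↦ hmem c t
  have hint : ∀ c : Z, IntegrableOn (fun t ↦ A (ext c t) (w t)) (Icc a b) := fun c ↦
    integrableOn_clm_apply (hAc c) (fun t _ ↦ hC _ (hmem c t)) hw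
  let S : Z → ℝ → E := fun c t ↦ x₀ + ∫ s in a..t, A (ext c s) (w s)
  have hSc : ∀ c, ContinuousOn (S c) (Icc a b) := fun c ↦
    continuousOn_const.add (intervalIntegral.continuousOn_primitive_interval
      (by rw [uIcc_of_le hab]; exact hint c) |>.mono (by rw [uIcc_of_le hab]))
  have hSm : ∀ c, ∀ t ∈ Icc a b, S c t ∈ closedBall x₀ ρ := by
    intro c t ht
    rw [mem_closedBall, dist_eq_norm, add_sub_cancel_left]
    calc ‖∫ s in a..t, A (ext c s) (w s)‖ ≤ ∫ s in a..t, C * ‖w s‖ := by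
          refine intervalIntegral.norm_integral_le_of_norm_le ht.1
            (Eventually.of_forall fun s _ ↦ ((A _).le_opNorm _).trans ?_)
            ((intervalIntegrable_of_mem_Icc hnw ha ht).const_mul C)
          gcongr
          exact hC _ (hmem c s)
      _ = C * ∫ s in a..t, ‖w s‖ := intervalIntegral.integral_const_mul _ _
      _ ≤ C * ∫ s in a..b, ‖w s‖ := by gcongr; exact hmono t ht
      _ ≤ ρ := hCw
  let T : Z → Z := fun c ↦ ⟨fun t ↦ ⟨S c t, hSm c t t.2⟩,
    ((continuousOn_iff_continuous_domRestrict.1 (hSc c)).subtype_mk _)⟩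
  have hw0 : 0 ≤ ∫ t in a..b, ‖w t‖ :=
    intervalIntegral.integral_nonneg hab fun _ _ ↦ norm_nonneg _
  let q : ℝ≥0 := K * ⟨∫ t in a..b, ‖w t‖, hw0⟩
  have hT : ContractingWith q T := by
    refine ⟨by rw [← NNReal.coe_lt_coe]; exact hKw, LipschitzWith.of_dist_le_mul fun c c' ↦ ?_⟩
    rw [ContinuousMap.dist_le (by positivity)]
    intro t
    rw [Subtype.dist_eq]
    change dist (S c t) (S c' t) ≤ _
    rw [dist_add_left, dist_eq_norm, ← intervalIntegral.integral_sub
      (intervalIntegrable_of_mem_Icc (hint c) ha t.2) (intervalIntegrable_of_mem_Icc (hint c') ha t.2)]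
    calc ‖∫ s in a..(t : ℝ), (A (ext c s) (w s) - A (ext c' s) (w s))‖
        ≤ ∫ s in a..(t : ℝ), (K * dist c c') * ‖w s‖ := by
          refine intervalIntegral.norm_integral_le_of_norm_le t.2.1
            (Eventually.of_forall fun s _ ↦ ?_)
            ((intervalIntegrable_of_mem_Icc hnw ha t.2).const_mul _)
          rw [← sub_apply]
          refine ((A _ - A _).le_opNorm _).trans ?_
          gcongr
          rw [← dist_eq_norm]
          refine (hA.dist_le_mul _ (hmem c s) _ (hmem c' s)).trans ?_
          gcongr
          exact ContinuousMap.dist_apply_le_dist (f := c) (g := c') _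
      _ = (K * dist c c') * ∫ s in a..(t : ℝ), ‖w s‖ := intervalIntegral.integral_const_mul _ _
      _ ≤ (K * dist c c') * ∫ s in a..b, ‖w s‖ := by gcongr; exact hmono t t.2
      _ = q * dist c c' := by
          change _ = (K * ∫ s in a..b, ‖w s‖) * dist c c'
          ring
  have : CompleteSpace (closedBall x₀ ρ) := isClosed_closedBall.completeSpace_coe
  have : Nonempty Z := ⟨ContinuousMap.const _ ⟨x₀, by simpa using hρ⟩⟩
  obtain ⟨c, hc⟩ : ∃ c, T c = c := ⟨_, hT.fixedPoint_isFixedPt⟩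
  refine ⟨ext c, (hext c).continuousOn, fun t _ ↦ hmem c t, fun t ht ↦ ?_⟩
  have h1 : ext c t = S c t := by
    have h2 : ((T c) ⟨t, ht⟩ : E) = S c t := rfl
    rw [← h2, hc]
    simp only [ext, projIcc_of_mem hab ht]
  exact h1

/-- Local uniqueness for the controlled differential equation `η' = A(η) w` with an integrable
control `w`. -/
theorem eqOn_of_eq_integral_of_lipschitzOnWith {A : E → U →L[ℝ] E} {S : Set E} {K : ℝ≥0} {C : ℝ}
    {a b : ℝ} {w : ℝ → U} {x₀ : E} {η₁ η₂ : ℝ → E} (hA : LipschitzOnWith K A S)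
    (hC : ∀ y ∈ S, ‖A y‖ ≤ C)
    (hw : IntegrableOn w (Icc a b)) (hKw : K * ∫ t in a..b, ‖w t‖ < 1)
    (h₁ : ContinuousOn η₁ (Icc a b)) (h₂ : ContinuousOn η₂ (Icc a b))
    (hS₁ : MapsTo η₁ (Icc a b) S) (hS₂ : MapsTo η₂ (Icc a b) S)
    (he₁ : ∀ t ∈ Icc a b, η₁ t = x₀ + ∫ s in a..t, A (η₁ s) (w s))
    (he₂ : ∀ t ∈ Icc a b, η₂ t = x₀ + ∫ s in a..t, A (η₂ s) (w s)) :
    EqOn η₁ η₂ (Icc a b) := by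
  rcases (Icc a b).eq_empty_or_nonempty with he | hne
  · rw [he]; exact eqOn_empty _ _
  have hab : a ≤ b := nonempty_Icc.1 hne
  have ha : a ∈ Icc a b := left_mem_Icc.2 hab
  have hnw : IntegrableOn (fun t ↦ ‖w t‖) (Icc a b) := hw.norm
  obtain ⟨t₀, ht₀, hmax⟩ := isCompact_Icc.exists_isMaxOn hne (h₁.sub h₂).norm
  set m := ‖η₁ t₀ - η₂ t₀‖ with hm
  have hmax' : ∀ s ∈ Icc a b, ‖η₁ s - η₂ s‖ ≤ m := fun s hs ↦ hmax hs
  have hint₁ : IntegrableOn (fun s ↦ A (η₁ s) (w s)) (Icc a b) :=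
    integrableOn_clm_apply (hA.continuousOn.comp h₁ hS₁) (fun t ht ↦ hC _ (hS₁ ht)) hw
  have hint₂ : IntegrableOn (fun s ↦ A (η₂ s) (w s)) (Icc a b) :=
    integrableOn_clm_apply (hA.continuousOn.comp h₂ hS₂) (fun t ht ↦ hC _ (hS₂ ht)) hw
  -- The largest gap `m` is at most a factor smaller than one times itself, hence zero.
  have hle : m ≤ (K * ∫ t in a..b, ‖w t‖) * m := by
    calc m = ‖∫ s in a..t₀, (A (η₁ s) (w s) - A (η₂ s) (w s))‖ := by
          rw [hm, he₁ t₀ ht₀, he₂ t₀ ht₀, add_sub_add_left_eq_sub,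
            ← intervalIntegral.integral_sub (intervalIntegrable_of_mem_Icc hint₁ ha ht₀)
              (intervalIntegrable_of_mem_Icc hint₂ ha ht₀)]
      _ ≤ ∫ s in a..t₀, (K * m) * ‖w s‖ := by
          refine intervalIntegral.norm_integral_le_of_norm_le ht₀.1
            (Eventually.of_forall fun s hs ↦ ?_)
            ((intervalIntegrable_of_mem_Icc hnw ha ht₀).const_mul _)
          have hs' : s ∈ Icc a b := ⟨hs.1.le, hs.2.trans ht₀.2⟩
          rw [← sub_apply]
          refine ((A _ - A _).le_opNorm _).trans ?_
          gcongr
          rw [← dist_eq_norm]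
          refine (hA.dist_le_mul _ (hS₁ hs') _ (hS₂ hs')).trans ?_
          gcongr
          rw [dist_eq_norm]
          exact hmax' s hs'
      _ = (K * m) * ∫ s in a..t₀, ‖w s‖ := intervalIntegral.integral_const_mul _ _
      _ ≤ (K * m) * ∫ s in a..b, ‖w s‖ := by
          gcongr
          exact intervalIntegral.integral_mono_interval le_rfl ht₀.1 ht₀.2
            (Eventually.of_forall fun _ ↦ norm_nonneg _)
            (intervalIntegrable_of_mem_Icc hnw ha (right_mem_Icc.2 hab))
      _ = _ := by ring
  have hm0 : m = 0 := by
    have : 0 ≤ m := norm_nonneg _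
    nlinarith
  intro s hs
  have := hmax' s hs
  rw [hm0] at this
  exact sub_eq_zero.1 (norm_le_zero_iff.1 this)

end Caratheodory

/-! ### Horizontal curves and the Carnot–Carathéodory distance -/

section HorizontalCurves

variable {m n r : ℕ} {G : Type*} [TopologicalSpace G] [ChartedSpace (EuclideanSpace ℝ (Fin n)) G]
  {H : Type*} [TopologicalSpace H] [ChartedSpace (EuclideanSpace ℝ (Fin m)) H]

theorem IsACCurve.map {γ : ℝ → G} {a b : ℝ} (hγ : IsACCurve n γ a b) {Φ : G → H}
    (hΦ : ContMDiff (𝓡 n) (𝓡 m) ∞ Φ) : IsACCurve m (Φ ∘ γ) a b :=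
  ⟨hΦ.continuous.comp_continuousOn hγ.1, fun f hf ↦ hγ.2 (f ∘ Φ) (hf.comp hΦ)⟩

theorem IsACCurve.mono {γ : ℝ → G} {a b c d : ℝ} (hγ : IsACCurve n γ a b) (hcd : c ≤ d)
    (hac : a ≤ c) (hdb : d ≤ b) : IsACCurve n γ c d :=
  ⟨hγ.1.mono (Icc_subset_Icc hac hdb), fun f hf ↦ (hγ.2 f hf).mono (by
    rw [uIcc_of_le hcd, uIcc_of_le (hac.trans (hcd.trans hdb))]; exact Icc_subset_Icc hac hdb)⟩

theorem IsACCurve.congr_on {γ γ' : ℝ → G} {a b : ℝ} (hγ : IsACCurve n γ a b) (hab : a ≤ b)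
    (h : EqOn γ' γ (Icc a b)) : IsACCurve n γ' a b :=
  ⟨hγ.1.congr h, fun f hf ↦ (hγ.2 f hf).congr_on fun t ht ↦ by
    rw [uIcc_of_le hab] at ht; simp [h ht]⟩

theorem IsACCurve.trans {γ : ℝ → G} {a b c : ℝ} (hab : a ≤ b) (hbc : b ≤ c)
    (h₁ : IsACCurve n γ a b) (h₂ : IsACCurve n γ b c) : IsACCurve n γ a c :=
  ⟨by rw [← Icc_union_Icc_eq_Icc hab hbc]
      exact h₁.1.union_of_isClosed h₂.1 isClosed_Icc isClosed_Icc,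
    fun f hf ↦ (h₁.2 f hf).trans hab hbc (h₂.2 f hf)⟩

variable [Group G] [Group H] {X : Fin r → GroupLieAlgebra (𝓡 n) G} {Y : Fin r → GroupLieAlgebra (𝓡 m) H}
  {a b : ℝ} {γ : ℝ → G} {u : ℝ → EuclideanSpace ℝ (Fin r)}

/-- By the chain rule, relating the frames is enough to keep the controls, hence the length. This
serves both for left translations and for `F`. -/
theorem IsHorizontalCurve.map (hγ : IsHorizontalCurve X a b γ u) {Φ : G → H}
    (hΦ : ContMDiff (𝓡 n) (𝓡 m) ∞ Φ)
    (hXY : ∀ j x, mfderiv (𝓡 n) (𝓡 m) Φ x (mulInvariantVectorField (X j) x) =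
      mulInvariantVectorField (Y j) (Φ x)) : IsHorizontalCurve Y a b (Φ ∘ γ) u := by
  refine ⟨hγ.1.map hΦ, hγ.2.1, ?_⟩
  filter_upwards [hγ.2.2] with t ht
  have h1 := ((hΦ.mdifferentiable (by simp)) (γ t)).hasMFDerivAt.comp t ht
  refine h1.congr_mfderiv (ContinuousLinearMap.ext fun (c : ℝ) ↦ ?_)
  change mfderiv (𝓡 n) (𝓡 m) Φ (γ t) (c • ∑ j, u t j • mulInvariantVectorField (X j) (γ t)) =
    c • ∑ j, u t j • mulInvariantVectorField (Y j) (Φ (γ t))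
  simp only [map_smul, map_sum, hXY]

theorem IsHorizontalCurve.mono (hγ : IsHorizontalCurve X a b γ u) {c d : ℝ} (hcd : c ≤ d)
    (hac : a ≤ c) (hdb : d ≤ b) : IsHorizontalCurve X c d γ u :=
  ⟨hγ.1.mono hcd hac hdb, hγ.2.1.mono_set (Icc_subset_Icc hac hdb),
    ae_mono (Measure.restrict_mono (Icc_subset_Icc hac hdb) le_rfl) hγ.2.2⟩

/-- Preservation of Lebesgue measure forces `|σ| = 1`, so this covers translations and reflections
of time. -/
theorem IsHorizontalCurve.comp_mul_add (hγ : IsHorizontalCurve X a b γ u) {c d σ τ : ℝ}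
    (hσ : σ ≠ 0) (hcd : c ≤ d) (hab : a ≤ b)
    (hm : MeasurePreserving (fun t : ℝ ↦ σ * t + τ))
    (himg : (fun t ↦ σ * t + τ) ⁻¹' Icc a b = Icc c d) :
    IsHorizontalCurve X c d (fun t ↦ γ (σ * t + τ)) (fun t ↦ σ • u (σ * t + τ)) := by
  have hmaps : MapsTo (fun t ↦ σ * t + τ) (Icc c d) (Icc a b) := fun t ht ↦ by
    rw [← himg] at ht; exact ht
  refine ⟨⟨hγ.1.1.comp (by fun_prop) hmaps, fun f hf ↦ ?_⟩, ?_, ?_⟩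
  · have h1 := (hγ.1.2 f hf).mono (c := σ * c + τ) (d := σ * d + τ) (by
      rw [uIcc_of_le hab]
      exact uIcc_subset_Icc (hmaps (left_mem_Icc.2 hcd)) (hmaps (right_mem_Icc.2 hcd)))
    exact AbsolutelyContinuousOnInterval.comp_mul_add (h := f ∘ γ) hσ h1
  · have hemb : MeasurableEmbedding (fun t : ℝ ↦ σ * t + τ) :=
      ((Homeomorph.mulLeft₀ σ hσ).trans (Homeomorph.addRight τ)).measurableEmbedding
    have := (hm.integrableOn_comp_preimage hemb (s := Icc a b) (f := u)).2 hγ.2.1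
    rw [himg] at this
    exact this.smul σ
  · have h1 := (hm.restrict_preimage (measurableSet_Icc (a := a) (b := b))).quasiMeasurePreserving.ae
      hγ.2.2
    rw [himg] at h1
    filter_upwards [h1] with t ht
    have h2 : HasMFDerivAt 𝓘(ℝ) 𝓘(ℝ) (fun t : ℝ ↦ σ * t + τ) t
        ((1 : ℝ →L[ℝ] ℝ).smulRight σ) := by
      have h3 : HasDerivAt (fun t : ℝ ↦ σ * t + τ) σ t := by
        simpa using ((hasDerivAt_id t).const_mul σ).add_const τ
      exact h3.hasFDerivAt.hasMFDerivAt
    have h4 := ht.comp t h2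
    refine h4.congr_mfderiv (ContinuousLinearMap.ext fun (c : ℝ) ↦ ?_)
    change (c • σ) • ∑ j, u (σ * t + τ) j • mulInvariantVectorField (X j) (γ (σ * t + τ)) =
      c • ∑ j, (σ * u (σ * t + τ) j) • mulInvariantVectorField (X j) (γ (σ * t + τ))
    simp only [Finset.smul_sum, smul_smul, smul_eq_mul, mul_assoc]

theorem IsHorizontalCurve.comp_add_right (hγ : IsHorizontalCurve X a b γ u) (hab : a ≤ b) (τ : ℝ) :
    IsHorizontalCurve X (a - τ) (b - τ) (fun t ↦ γ (t + τ)) (fun t ↦ u (t + τ)) := by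
  have := hγ.comp_mul_add (c := a - τ) (d := b - τ) (σ := 1) (τ := τ) one_ne_zero (by linarith) hab
    (by simpa using measurePreserving_add_right volume τ) (by simp)
  simpa using this

theorem IsHorizontalCurve.reverse (hγ : IsHorizontalCurve X a b γ u) (hab : a ≤ b) :
    IsHorizontalCurve X a b (fun t ↦ γ (a + b - t)) (fun t ↦ -u (a + b - t)) := by
  have := hγ.comp_mul_add (c := a) (d := b) (σ := -1) (τ := a + b) (by simp) hab hab
    (by
      have := Measure.measurePreserving_sub_left (volume : Measure ℝ) (a + b)
      have e : (fun t : ℝ ↦ -1 * t + (a + b)) = fun t ↦ a + b - t := by ext t; ring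
      rwa [e])
    (by
      ext t
      simp only [mem_preimage, mem_Icc]
      constructor <;> rintro ⟨h1, h2⟩ <;> constructor <;> linarith)
  have e : ∀ t : ℝ, -1 * t + (a + b) = a + b - t := fun t ↦ by ring
  simp only [e] at this
  simpa using this

theorem IsHorizontalCurve.congr_on {γ' : ℝ → G} {u' : ℝ → EuclideanSpace ℝ (Fin r)}
    (hγ : IsHorizontalCurve X a b γ u) (hab : a ≤ b) (h : EqOn γ' γ (Icc a b))
    (hu : EqOn u' u (Ioo a b)) : IsHorizontalCurve X a b γ' u' := by
  have hu' : u' =ᵐ[volume.restrict (Icc a b)] u := by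
    rw [← restrict_Ioo_eq_restrict_Icc]
    filter_upwards [ae_restrict_mem measurableSet_Ioo] with t ht using hu ht
  refine ⟨hγ.1.congr_on hab h, hγ.2.1.congr_fun_ae hu'.symm, ?_⟩
  have h2 := hγ.2.2
  -- The derivative is two-sided, so the curves must agree in a neighbourhood of `t`; discarding the
  -- endpoints, a null set, ensures this.
  rw [← restrict_Ioo_eq_restrict_Icc] at h2 ⊢
  filter_upwards [h2, ae_restrict_mem measurableSet_Ioo] with t ht hto
  have hev : γ' =ᶠ[𝓝 t] γ := by
    filter_upwards [isOpen_Ioo.mem_nhds hto] with s hs using h (Ioo_subset_Icc_self hs)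
  rw [hu hto]
  have h3 := ht.congr_of_eventuallyEq hev
  have h4 : γ' t = γ t := h (Ioo_subset_Icc_self hto)
  convert h3 using 1
  rw [h4]

theorem IsHorizontalCurve.union {c : ℝ} (hab : a ≤ b) (hbc : b ≤ c)
    (h₁ : IsHorizontalCurve X a b γ u) (h₂ : IsHorizontalCurve X b c γ u) :
    IsHorizontalCurve X a c γ u := by
  refine ⟨h₁.1.trans hab hbc h₂.1, ?_, ?_⟩
  · rw [← Icc_union_Icc_eq_Icc hab hbc]
    exact h₁.2.1.union h₂.2.1
  · rw [← Icc_union_Icc_eq_Icc hab hbc, ae_restrict_union_iff]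
    exact ⟨h₁.2.2, h₂.2.2⟩

theorem IsHorizontalCurve.trans {c : ℝ} {γ' : ℝ → G} {u' : ℝ → EuclideanSpace ℝ (Fin r)}
    (hab : a ≤ b) (hbc : b ≤ c) (h₁ : IsHorizontalCurve X a b γ u)
    (h₂ : IsHorizontalCurve X b c γ' u') (h : γ b = γ' b) :
    IsHorizontalCurve X a c (fun t ↦ if t ≤ b then γ t else γ' t)
      (fun t ↦ if t ≤ b then u t else u' t) := by
  refine (h₁.congr_on hab (fun t ht ↦ if_pos ht.2) (fun t ht ↦ if_pos ht.2.le)).union hab hbc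
    (h₂.congr_on hbc (fun t ht ↦ ?_) (fun t ht ↦ if_neg (not_le.2 ht.1)))
  rcases ht.1.eq_or_lt with rfl | h'
  · simp [h]
  · exact if_neg (not_le.2 h')

/-- The fundamental theorem of calculus for a smooth function along a horizontal curve. -/
theorem IsHorizontalCurve.integral_eq_sub (hγ : IsHorizontalCurve X a b γ u) (hab : a ≤ b)
    {f : G → ℝ} (hf : ContMDiff (𝓡 n) 𝓘(ℝ) ∞ f) :
    IntegrableOn (fun t ↦ ∑ j, u t j *
      (show ℝ from mfderiv (𝓡 n) 𝓘(ℝ) f (γ t) (mulInvariantVectorField (X j) (γ t)))) (Icc a b) ∧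
    ∫ t in a..b, ∑ j, u t j *
      (show ℝ from mfderiv (𝓡 n) 𝓘(ℝ) f (γ t) (mulInvariantVectorField (X j) (γ t))) =
      f (γ b) - f (γ a) := by
  have hac := hγ.1.2 f hf
  have hderiv : ∀ᵐ t ∂(volume.restrict (Icc a b)), deriv (f ∘ γ) t = ∑ j, u t j *
      (show ℝ from mfderiv (𝓡 n) 𝓘(ℝ) f (γ t) (mulInvariantVectorField (X j) (γ t))) := by
    filter_upwards [hγ.2.2] with t ht
    have h1 := ((hf.mdifferentiable (by simp)) (γ t)).hasMFDerivAt.comp t ht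
    let D : ℝ →L[ℝ] ℝ := (mfderiv (𝓡 n) 𝓘(ℝ) f (γ t)).comp
      ((1 : ℝ →L[ℝ] ℝ).smulRight (∑ j, u t j • mulInvariantVectorField (X j) (γ t)))
    have h2 : HasFDerivAt (f ∘ γ) D t := h1.hasFDerivAt
    rw [h2.hasDerivAt.deriv]
    change mfderiv (𝓡 n) 𝓘(ℝ) f (γ t)
      ((1 : ℝ) • ∑ j, u t j • mulInvariantVectorField (X j) (γ t)) = _
    simp only [one_smul, map_sum, map_smul]
    rfl
  have hint := hac.intervalIntegrable_deriv
  rw [intervalIntegrable_iff_integrableOn_Icc_of_le hab] at hint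
  refine ⟨hint.congr_fun_ae hderiv, ?_⟩
  rw [← Function.comp_apply (f := f) (g := γ), ← Function.comp_apply (f := f) (g := γ),
    ← hac.integral_deriv_eq_sub]
  refine intervalIntegral.integral_congr_ae ?_
  rw [uIoc_of_le hab]
  rw [ae_restrict_iff' measurableSet_Icc] at hderiv
  filter_upwards [hderiv] with t ht h't using (ht (Ioc_subset_Icc_self h't)).symm

theorem ccEDist_le (hγ : IsHorizontalCurve X a b γ u) (hab : a ≤ b) :
    ccEDist X (γ a) (γ b) ≤ ENNReal.ofReal (∫ t in a..b, ‖u t‖) :=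
  sInf_le ⟨a, b, γ, u, hab, hγ, rfl, rfl, rfl⟩

theorem exists_isHorizontalCurve_of_ccEDist_lt {x y : G} {ℓ : ℝ≥0∞} (h : ccEDist X x y < ℓ) :
    ∃ (a b : ℝ) (γ : ℝ → G) (u : ℝ → EuclideanSpace ℝ (Fin r)), a ≤ b ∧
      IsHorizontalCurve X a b γ u ∧ γ a = x ∧ γ b = y ∧
      ENNReal.ofReal (∫ t in a..b, ‖u t‖) < ℓ := by
  obtain ⟨_, ⟨a, b, γ, u, hab, hγ, hx, hy, rfl⟩, hlt⟩ := sInf_lt_iff.1 h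
  exact ⟨a, b, γ, u, hab, hγ, hx, hy, hlt⟩

theorem ccEDist_map_le {Φ : G → H} (hΦ : ContMDiff (𝓡 n) (𝓡 m) ∞ Φ)
    (hXY : ∀ j x, mfderiv (𝓡 n) (𝓡 m) Φ x (mulInvariantVectorField (X j) x) =
      mulInvariantVectorField (Y j) (Φ x)) (x y : G) :
    ccEDist Y (Φ x) (Φ y) ≤ ccEDist X x y := by
  refine le_of_forall_gt fun ℓ hℓ ↦ ?_
  obtain ⟨a, b, γ, u, hab, hγ, rfl, rfl, hlt⟩ := exists_isHorizontalCurve_of_ccEDist_lt hℓ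
  exact (ccEDist_le (hγ.map hΦ hXY) hab).trans_lt hlt

theorem ccEDist_comm (x y : G) : ccEDist X x y = ccEDist X y x := by
  have key : ∀ x y : G, ccEDist X x y ≤ ccEDist X y x := by
    intro x y
    refine le_of_forall_gt fun ℓ hℓ ↦ ?_
    obtain ⟨a, b, γ, u, hab, hγ, rfl, rfl, hlt⟩ := exists_isHorizontalCurve_of_ccEDist_lt hℓ
    have := ccEDist_le (hγ.reverse hab) hab
    simp only [add_sub_cancel_left, add_sub_cancel_right, norm_neg,
      intervalIntegral.integral_comp_sub_left (fun t ↦ ‖u t‖)] at this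
    exact this.trans_lt hlt
  exact le_antisymm (key x y) (key y x)

theorem ccEDist_triangle (x y z : G) : ccEDist X x z ≤ ccEDist X x y + ccEDist X y z := by
  refine le_of_forall_gt fun ℓ hℓ ↦ ?_
  by_cases h1 : ccEDist X x y = ⊤
  · simp [h1] at hℓ
  by_cases h2 : ccEDist X y z = ⊤
  · simp [h2] at hℓ
  obtain ⟨p, hp, q, hq, hpq⟩ : ∃ p > ccEDist X x y, ∃ q > ccEDist X y z, p + q ≤ ℓ := by
    obtain ⟨ε, hε, hlt⟩ : ∃ ε : ℝ≥0∞, 0 < ε ∧ ccEDist X x y + ccEDist X y z + ε < ℓ := by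
      obtain ⟨c, hc1, hc2⟩ := exists_between hℓ
      exact ⟨c - (ccEDist X x y + ccEDist X y z), tsub_pos_of_lt hc1, by
        rwa [add_tsub_cancel_of_le hc1.le]⟩
    refine ⟨ccEDist X x y + ε / 2, ENNReal.lt_add_right h1 (by simp [hε.ne']),
      ccEDist X y z + ε / 2, ENNReal.lt_add_right h2 (by simp [hε.ne']), ?_⟩
    rw [add_add_add_comm, ENNReal.add_halves]
    exact hlt.le
  obtain ⟨a, b, γ, u, hab, hγ, rfl, hy, hlt⟩ := exists_isHorizontalCurve_of_ccEDist_lt hp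
  obtain ⟨c, d, γ', u', hcd, hγ', hy', rfl, hlt'⟩ := exists_isHorizontalCurve_of_ccEDist_lt hq
  -- The second curve is shifted in time so as to start at `b`.
  have hγs := hγ'.comp_add_right hcd (c - b)
  have e1 : c - (c - b) = b := by ring
  have e2 : d - (c - b) = b + (d - c) := by ring
  rw [e1, e2] at hγs
  have hbd : b ≤ b + (d - c) := by linarith
  have e3 : b + (d - c) + (c - b) = d := by ring
  have hcat := hγ.trans hab hbd hγs (by simp [hy, hy'])
  have hle := ccEDist_le hcat (hab.trans hbd)
  -- If `c = d`, the final time is `b` and falls in the first branch; the value is still `γ' d`.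
  have hend : (if b + (d - c) ≤ b then γ (b + (d - c)) else γ' (b + (d - c) + (c - b))) = γ' d := by
    rw [e3]
    split_ifs with h
    · have : d = c := by linarith
      subst this
      simp [hy, hy']
    · rfl
  simp only [hab, if_true, hend] at hle
  refine hle.trans_lt (lt_of_lt_of_le ?_ hpq)
  have hi : IntegrableOn (fun t ↦ ‖if t ≤ b then u t else u' (t + (c - b))‖)
      (Icc a (b + (d - c))) := hcat.2.1.norm
  rw [← intervalIntegral.integral_add_adjacent_intervals
    (intervalIntegrable_of_mem_Icc hi (s := a) (t := b) ⟨le_rfl, hab.trans hbd⟩ ⟨hab, hbd⟩)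
    (intervalIntegrable_of_mem_Icc hi (s := b) (t := b + (d - c)) ⟨hab, hbd⟩
      ⟨hab.trans hbd, le_rfl⟩)]
  have i1 : ∫ t in a..b, ‖if t ≤ b then u t else u' (t + (c - b))‖ = ∫ t in a..b, ‖u t‖ := by
    refine intervalIntegral.integral_congr_ae (Eventually.of_forall fun t ht ↦ ?_)
    rw [uIoc_of_le hab] at ht
    simp [ht.2]
  have i2 : ∫ t in b..(b + (d - c)), ‖if t ≤ b then u t else u' (t + (c - b))‖ =
      ∫ t in c..d, ‖u' t‖ := by
    have : ∫ t in b..(b + (d - c)), ‖u' (t + (c - b))‖ = ∫ t in c..d, ‖u' t‖ := by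
      rw [intervalIntegral.integral_comp_add_right (fun t ↦ ‖u' t‖), e3, add_sub_cancel]
    rw [← this]
    refine intervalIntegral.integral_congr_ae (Eventually.of_forall fun t ht ↦ ?_)
    rw [uIoc_of_le hbd] at ht
    simp [not_le.2 ht.1]
  rw [i1, i2]
  refine (ENNReal.ofReal_add_le).trans_lt ?_
  exact ENNReal.add_lt_add hlt hlt'

theorem mfderiv_mul_left_mulInvariantVectorField [LieGroup (𝓡 n) ∞ G]
    (v : GroupLieAlgebra (𝓡 n) G) (g x : G) :
    mfderiv (𝓡 n) (𝓡 n) (fun y ↦ g * y) x (mulInvariantVectorField v x) =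
      mulInvariantVectorField v (g * x) := by
  have hd : ∀ g x : G, MDifferentiableAt (𝓡 n) (𝓡 n) (fun y : G ↦ g * y) x := fun g x ↦
    (contMDiff_mul_left (I := 𝓡 n) (n := ∞) (a := g)).mdifferentiable (by simp) x
  have h1 : (fun y : G ↦ g * x * y) = (fun y ↦ g * y) ∘ (fun y ↦ x * y) := by
    ext y; simp [mul_assoc]
  have h2 : mfderiv (𝓡 n) (𝓡 n) (fun y : G ↦ g * x * y) 1 =
      (mfderiv (𝓡 n) (𝓡 n) (fun y ↦ g * y) (x * 1)).comp
        (mfderiv (𝓡 n) (𝓡 n) (fun y ↦ x * y) 1) := by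
    rw [h1]
    exact mfderiv_comp (I' := 𝓡 n) (1 : G) (hd _ _) (hd _ _)
  have h3 : mulInvariantVectorField v (g * x) =
      mfderiv (𝓡 n) (𝓡 n) (fun y ↦ g * y) (x * 1)
        (mfderiv (𝓡 n) (𝓡 n) (fun y ↦ x * y) 1 v) :=
    congrArg (fun A : EuclideanSpace ℝ (Fin n) →L[ℝ] EuclideanSpace ℝ (Fin n) ↦ A v) h2
  -- The base points `x * 1` and `x` are only propositionally equal, so the derivative is
  -- transported along the equality in the model space.
  have h4 : ∀ z, z = x → ∀ w : EuclideanSpace ℝ (Fin n),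
      (mfderiv (𝓡 n) (𝓡 n) (fun y ↦ g * y) x w : EuclideanSpace ℝ (Fin n)) =
        mfderiv (𝓡 n) (𝓡 n) (fun y ↦ g * y) z w := by
    rintro _ rfl w
    rfl
  exact (h4 _ (mul_one x) _).trans h3.symm

theorem ccEDist_mul_left [LieGroup (𝓡 n) ∞ G] (g x y : G) :
    ccEDist X (g * x) (g * y) = ccEDist X x y := by
  have key : ∀ g x y : G, ccEDist X (g * x) (g * y) ≤ ccEDist X x y := fun g x y ↦
    ccEDist_map_le (Φ := fun y ↦ g * y) (contMDiff_mul_left (I := 𝓡 n) (n := ∞) (a := g))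
      (fun j x ↦ mfderiv_mul_left_mulInvariantVectorField (X j) g x) x y
  refine le_antisymm (key g x y) ?_
  simpa using key g⁻¹ (g * x) (g * y)

end HorizontalCurves

/-! ### Vector fields read in a chart -/

section ChartVectorField

open VectorField

variable {n r : ℕ} {G : Type*} [TopologicalSpace G] [ChartedSpace (EuclideanSpace ℝ (Fin n)) G]

/-- A vector field read in the chart at `p`. -/
noncomputable def chartVectorField (p : G) (V : (x : G) → TangentSpace (𝓡 n) x) :
    EuclideanSpace ℝ (Fin n) → EuclideanSpace ℝ (Fin n) :=
  mpullback 𝓘(ℝ, EuclideanSpace ℝ (Fin n)) (𝓡 n) (extChartAt (𝓡 n) p).symm V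

variable [IsManifold (𝓡 n) ∞ G]

theorem contMDiffAt_extChartAt_symm_of_mem {p : G} {y : EuclideanSpace ℝ (Fin n)}
    (hy : y ∈ (extChartAt (𝓡 n) p).target) :
    ContMDiffAt 𝓘(ℝ, EuclideanSpace ℝ (Fin n)) (𝓡 n) ∞ (extChartAt (𝓡 n) p).symm y :=
  (contMDiffOn_extChartAt_symm p).contMDiffAt ((isOpen_extChartAt_target p).mem_nhds hy)

theorem contMDiffAt_extChartAt_of_mem {p x : G} (hx : x ∈ (extChartAt (𝓡 n) p).source) :
    ContMDiffAt (𝓡 n) 𝓘(ℝ, EuclideanSpace ℝ (Fin n)) ∞ (extChartAt (𝓡 n) p) x :=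
  contMDiffAt_extChartAt' (by rwa [extChartAt_source] at hx)

theorem isInvertible_mfderiv_extChartAt_symm {p : G} {y : EuclideanSpace ℝ (Fin n)}
    (hy : y ∈ (extChartAt (𝓡 n) p).target) :
    (mfderiv 𝓘(ℝ, EuclideanSpace ℝ (Fin n)) (𝓡 n) (extChartAt (𝓡 n) p).symm y).IsInvertible := by
  have := IsManifold.of_le (I := 𝓡 n) (M := G) (m := 1) (n := ∞) ENat.LEInfty.out
  have := isInvertible_mfderivWithin_extChartAt_symm hy
  simpa using this

theorem mfderiv_extChartAt_symm_chartVectorField {p : G} {y : EuclideanSpace ℝ (Fin n)}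
    (hy : y ∈ (extChartAt (𝓡 n) p).target) (V : (x : G) → TangentSpace (𝓡 n) x) :
    mfderiv 𝓘(ℝ, EuclideanSpace ℝ (Fin n)) (𝓡 n) (extChartAt (𝓡 n) p).symm y
      (chartVectorField p V y) = V ((extChartAt (𝓡 n) p).symm y) :=
  (isInvertible_mfderiv_extChartAt_symm hy).self_apply_inverse _

theorem mfderiv_extChartAt_apply {p x : G} (hx : x ∈ (extChartAt (𝓡 n) p).source)
    (V : (x : G) → TangentSpace (𝓡 n) x) :
    mfderiv (𝓡 n) 𝓘(ℝ, EuclideanSpace ℝ (Fin n)) (extChartAt (𝓡 n) p) x (V x) =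
      chartVectorField p V (extChartAt (𝓡 n) p x) := by
  have hy := (extChartAt (𝓡 n) p).map_source hx
  have h1 := mfderiv_extChartAt_symm_chartVectorField hy V
  have := IsManifold.of_le (I := 𝓡 n) (M := G) (m := 1) (n := ∞) ENat.LEInfty.out
  have h2 := mfderiv_extChartAt_comp_mfderivWithin_extChartAt_symm (I := 𝓡 n) hy
  have h3 := congrArg (fun A : EuclideanSpace ℝ (Fin n) →L[ℝ] EuclideanSpace ℝ (Fin n) ↦
    A (chartVectorField p V (extChartAt (𝓡 n) p x))) h2
  simp only [ModelWithCorners.range_eq_univ, mfderivWithin_univ] at h3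
  have h4 : ∀ z, z = x → ∀ w : EuclideanSpace ℝ (Fin n), w = V z →
      (mfderiv (𝓡 n) 𝓘(ℝ, EuclideanSpace ℝ (Fin n)) (extChartAt (𝓡 n) p) x (V x) :
        EuclideanSpace ℝ (Fin n)) =
      mfderiv (𝓡 n) 𝓘(ℝ, EuclideanSpace ℝ (Fin n)) (extChartAt (𝓡 n) p) z w := by
    rintro _ rfl w rfl
    rfl
  exact (h4 _ ((extChartAt (𝓡 n) p).left_inv hx) _ h1).trans h3

theorem contDiffAt_chartVectorField {p : G} {y : EuclideanSpace ℝ (Fin n)}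
    (hy : y ∈ (extChartAt (𝓡 n) p).target) {V : (x : G) → TangentSpace (𝓡 n) x}
    (hV : ContMDiff (𝓡 n) (𝓡 n).tangent 1 (fun x ↦ (⟨x, V x⟩ : TangentBundle (𝓡 n) G))) :
    ContDiffAt ℝ 1 (chartVectorField p V) y := by
  have := IsManifold.of_le (I := 𝓡 n) (M := G) (m := 1) (n := ∞) ENat.LEInfty.out
  have := IsManifold.of_le (I := 𝓡 n) (M := G) (m := 2) (n := ∞) ENat.LEInfty.out
  have h := ContMDiffAt.mpullback_vectorField_preimage (m := 1) (n := 2)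
    (hV ((extChartAt (𝓡 n) p).symm y))
    ((contMDiffAt_extChartAt_symm_of_mem hy).of_le ENat.LEInfty.out)
    (isInvertible_mfderiv_extChartAt_symm hy) (by norm_num)
  exact contMDiffAt_vectorSpace_iff_contDiffAt.1 h

end ChartVectorField

/-! ### Horizontal curves with prescribed controls -/

section HorizontalODE

open VectorField

variable {n r : ℕ} {G : Type*} [TopologicalSpace G] [ChartedSpace (EuclideanSpace ℝ (Fin n)) G]
  [Group G]

theorem LieGroup.minSmoothness_three [LieGroup (𝓡 n) ∞ G] :
    LieGroup (𝓡 n) (minSmoothness ℝ 3) G :=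
  LieGroup.of_le (n := ∞) (by simpa using ENat.LEInfty.out)

theorem contMDiff_one_mulInvariantVectorField [LieGroup (𝓡 n) ∞ G] (v : GroupLieAlgebra (𝓡 n) G) :
    ContMDiff (𝓡 n) (𝓡 n).tangent 1
      (fun x ↦ (⟨x, mulInvariantVectorField v x⟩ : TangentBundle (𝓡 n) G)) := by
  have := LieGroup.minSmoothness_three (n := n) (G := G)
  exact (contMDiff_mulInvariantVectorField v).of_le (by simp)

/-- The linear map `w ↦ ∑ j, w j • X j`, with the left invariant vector fields `X j` read in the
chart at `p`. -/
noncomputable def chartControl (X : Fin r → GroupLieAlgebra (𝓡 n) G) (p : G)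
    (y : EuclideanSpace ℝ (Fin n)) : EuclideanSpace ℝ (Fin r) →L[ℝ] EuclideanSpace ℝ (Fin n) :=
  ∑ j, (EuclideanSpace.proj j : EuclideanSpace ℝ (Fin r) →L[ℝ] ℝ).smulRight
    (chartVectorField p (mulInvariantVectorField (X j)) y)

theorem chartControl_apply (X : Fin r → GroupLieAlgebra (𝓡 n) G) (p : G)
    (y : EuclideanSpace ℝ (Fin n)) (w : EuclideanSpace ℝ (Fin r)) :
    chartControl X p y w = ∑ j, w j • chartVectorField p (mulInvariantVectorField (X j)) y := by
  simp [chartControl]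

variable [LieGroup (𝓡 n) ∞ G]

/-- The fields are C¹ in the chart, hence Lipschitz near the centre; `C` is the norm at the centre
plus `K * ρ`. -/
theorem exists_lipschitzOnWith_chartControl (X : Fin r → GroupLieAlgebra (𝓡 n) G) (p : G) :
    ∃ (ρ : ℝ) (K : ℝ≥0) (C : ℝ), 0 < ρ ∧ 0 ≤ C ∧
      closedBall (extChartAt (𝓡 n) p p) ρ ⊆ (extChartAt (𝓡 n) p).target ∧
      LipschitzOnWith K (chartControl X p) (closedBall (extChartAt (𝓡 n) p p) ρ) ∧
      ∀ y ∈ closedBall (extChartAt (𝓡 n) p p) ρ, ‖chartControl X p y‖ ≤ C := by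
  have hp := mem_extChartAt_target (I := 𝓡 n) p
  have hd : ContDiffAt ℝ 1 (chartControl X p) (extChartAt (𝓡 n) p p) := by
    have h : ∀ j, ContDiffAt ℝ 1 (chartVectorField p (mulInvariantVectorField (X j)))
        (extChartAt (𝓡 n) p p) := fun j ↦
      contDiffAt_chartVectorField hp (contMDiff_one_mulInvariantVectorField (X j))
    unfold chartControl
    refine ContDiffAt.sum fun j _ ↦ ?_
    exact contDiffAt_const.smulRight (h j)
  obtain ⟨K, t, ht, hK⟩ := hd.exists_lipschitzOnWith
  obtain ⟨ρ, hρ, hsub⟩ := nhds_basis_closedBall.mem_iff.1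
    (inter_mem ht ((isOpen_extChartAt_target p).mem_nhds hp))
  refine ⟨ρ, K, ‖chartControl X p (extChartAt (𝓡 n) p p)‖ + K * ρ, hρ, by positivity,
    fun y hy ↦ (hsub hy).2, hK.mono fun y hy ↦ (hsub hy).1, fun y hy ↦ ?_⟩
  have h1 := hK.dist_le_mul y (hsub hy).1 _ (hsub (mem_closedBall_self hρ.le)).1
  rw [dist_eq_norm] at h1
  have h2 : (K : ℝ) * dist y (extChartAt (𝓡 n) p p) ≤ K * ρ := by gcongr; exact hy
  linarith [norm_le_norm_add_norm_sub' (chartControl X p y)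
    (chartControl X p (extChartAt (𝓡 n) p p)), norm_sub_rev (chartControl X p y)
    (chartControl X p (extChartAt (𝓡 n) p p))]

theorem ContinuousLinearMap.map_smul_sum_smul {E F ι : Type*} [AddCommGroup E] [Module ℝ E]
    [TopologicalSpace E] [AddCommGroup F] [Module ℝ F] [TopologicalSpace F] [Fintype ι]
    (A : E →L[ℝ] F) (c : ℝ) (w : ι → ℝ) (v : ι → E) :
    A (c • ∑ j, w j • v j) = c • ∑ j, w j • A (v j) := by
  simp only [map_smul, map_sum]

/-- A solution of the controlled differential equation in a chart is a horizontal curve. -/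
theorem isHorizontalCurve_extChartAt_symm (X : Fin r → GroupLieAlgebra (𝓡 n) G) (p : G) {ρ C : ℝ}
    (hsub : closedBall (extChartAt (𝓡 n) p p) ρ ⊆ (extChartAt (𝓡 n) p).target)
    (hcont : ContinuousOn (chartControl X p) (closedBall (extChartAt (𝓡 n) p p) ρ))
    (hC : ∀ y ∈ closedBall (extChartAt (𝓡 n) p p) ρ, ‖chartControl X p y‖ ≤ C)
    {a b : ℝ} (hab : a ≤ b) {w : ℝ → EuclideanSpace ℝ (Fin r)} (hw : IntegrableOn w (Icc a b))
    {η : ℝ → EuclideanSpace ℝ (Fin n)} (hη : ContinuousOn η (Icc a b))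
    (hmem : ∀ t ∈ Icc a b, η t ∈ closedBall (extChartAt (𝓡 n) p p) ρ)
    {y₀ : EuclideanSpace ℝ (Fin n)}
    (heq : ∀ t ∈ Icc a b, η t = y₀ + ∫ s in a..t, chartControl X p (η s) (w s)) :
    IsHorizontalCurve X a b ((extChartAt (𝓡 n) p).symm ∘ η) w := by
  have ha : a ∈ Icc a b := left_mem_Icc.2 hab
  have hint : IntegrableOn (fun s ↦ chartControl X p (η s) (w s)) (Icc a b) :=
    integrableOn_clm_apply (hcont.comp hη hmem) (fun t ht ↦ hC _ (hmem t ht)) hw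
  have hnw : IntegrableOn (fun t ↦ ‖w t‖) (Icc a b) := hw.norm
  refine ⟨⟨(continuousOn_extChartAt_symm p).comp hη fun t ht ↦ hsub (hmem t ht), fun f hf ↦ ?_⟩,
    hw, ?_⟩
  · have hcd : ContDiffOn ℝ 1 (f ∘ (extChartAt (𝓡 n) p).symm)
        (closedBall (extChartAt (𝓡 n) p p) ρ) := by
      intro y hy
      have h1 := hf.contMDiffAt.comp y (contMDiffAt_extChartAt_symm_of_mem (hsub hy))
      exact (contMDiffAt_iff_contDiffAt.1 h1).contDiffWithinAt.of_le (by simp)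
    -- A C¹ function is Lipschitz on the compact convex ball, and the increments of `η` are
    -- dominated by those of the primitive of `C * ‖w‖`.
    obtain ⟨K, hK⟩ := hcd.exists_lipschitzOnWith (by simp) (convex_closedBall _ _)
      (isCompact_closedBall _ _)
    have hG : AbsolutelyContinuousOnInterval (fun t ↦ ∫ s in a..t, C * ‖w s‖) a b :=
      IntervalIntegrable.absolutelyContinuousOnInterval_intervalIntegral
        ((intervalIntegrable_of_mem_Icc hnw ha (right_mem_Icc.2 hab)).const_mul C) (by simp)
    refine hG.of_dist_le (C := K) fun s hs t ht ↦ ?_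
    rw [uIcc_of_le hab] at hs ht
    refine (hK.dist_le_mul _ (hmem s hs) _ (hmem t ht)).trans ?_
    gcongr
    rw [heq s hs, heq t ht, dist_add_left, dist_eq_norm, Real.dist_eq,
      intervalIntegral.integral_interval_sub_left (intervalIntegrable_of_mem_Icc hint ha hs)
        (intervalIntegrable_of_mem_Icc hint ha ht),
      intervalIntegral.integral_interval_sub_left
        ((intervalIntegrable_of_mem_Icc hnw ha hs).const_mul C)
        ((intervalIntegrable_of_mem_Icc hnw ha ht).const_mul C)]
    refine intervalIntegral.norm_integral_le_abs_of_norm_le ?_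
      ((intervalIntegrable_of_mem_Icc hnw ht hs).const_mul C)
    rw [ae_restrict_iff' measurableSet_uIoc]
    refine Eventually.of_forall fun q hq ↦ ((chartControl X p (η q)).le_opNorm _).trans ?_
    gcongr
    exact hC _ (hmem q (uIcc_subset_Icc ht hs (uIoc_subset_uIcc hq)))
  · have hI := intervalIntegrable_of_mem_Icc hint ha (right_mem_Icc.2 hab)
    have hae := hI.ae_hasDerivAt_integral
    rw [← restrict_Ioo_eq_restrict_Icc, ae_restrict_iff' measurableSet_Ioo]
    filter_upwards [hae] with t ht hto
    have htI : t ∈ Icc a b := Ioo_subset_Icc_self hto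
    have h1 := ht (by rw [uIcc_of_le hab]; exact htI) a (by simp)
    have h2 : HasDerivAt η (chartControl X p (η t) (w t)) t := by
      refine (h1.const_add y₀).congr_of_eventuallyEq ?_
      filter_upwards [isOpen_Ioo.mem_nhds hto] with s hs using heq s (Ioo_subset_Icc_self hs)
    have hy := hsub (hmem t htI)
    have h3 := ((contMDiffAt_extChartAt_symm_of_mem hy).mdifferentiableAt
      (by simp)).hasMFDerivAt.comp t h2.hasFDerivAt.hasMFDerivAt
    refine h3.congr_mfderiv (ContinuousLinearMap.ext fun (c : ℝ) ↦ ?_)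
    change mfderiv 𝓘(ℝ, EuclideanSpace ℝ (Fin n)) (𝓡 n) (extChartAt (𝓡 n) p).symm (η t)
      (c • chartControl X p (η t) (w t)) = c • ∑ j, w t j • mulInvariantVectorField (X j)
        ((extChartAt (𝓡 n) p).symm (η t))
    rw [chartControl_apply]
    refine (ContinuousLinearMap.map_smul_sum_smul (mfderiv 𝓘(ℝ, EuclideanSpace ℝ (Fin n)) (𝓡 n)
      (extChartAt (𝓡 n) p).symm (η t)) c (fun j ↦ w t j) _).trans ?_
    congr 1
    refine Finset.sum_congr rfl fun j _ ↦ ?_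
    rw [mfderiv_extChartAt_symm_chartVectorField hy]

/-- Controls of small length are realised by a horizontal curve, from any starting point. -/
theorem exists_isHorizontalCurve_of_small (X : Fin r → GroupLieAlgebra (𝓡 n) G) :
    ∃ ε : ℝ, 0 < ε ∧ ∀ (x : G) (a b : ℝ) (w : ℝ → EuclideanSpace ℝ (Fin r)), a ≤ b →
      IntegrableOn w (Icc a b) → ∫ t in a..b, ‖w t‖ ≤ ε →
      ∃ γ : ℝ → G, γ a = x ∧ IsHorizontalCurve X a b γ w := by
  obtain ⟨ρ, K, C, hρ, hC0, hsub, hK, hC⟩ := exists_lipschitzOnWith_chartControl X (1 : G)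
  -- The first term keeps the solution in the chart ball, the second makes the Picard operator
  -- contracting. Solving only at the identity and left translating makes the constant independent
  -- of `x`.
  refine ⟨min (ρ / (C + 1)) (1 / (K + 1) / 2), by positivity, fun x a b w hab hw hle ↦ ?_⟩
  have h1 := hle.trans (min_le_left _ _)
  have h2 := hle.trans (min_le_right _ _)
  have hCw : C * ∫ t in a..b, ‖w t‖ ≤ ρ := by
    calc C * ∫ t in a..b, ‖w t‖ ≤ (C + 1) * (ρ / (C + 1)) := by
          have : 0 ≤ ∫ t in a..b, ‖w t‖ :=
            intervalIntegral.integral_nonneg hab fun _ _ ↦ norm_nonneg _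
          gcongr
          linarith
      _ = ρ := by field_simp
  have hKw : K * ∫ t in a..b, ‖w t‖ < 1 := by
    calc K * ∫ t in a..b, ‖w t‖ ≤ K * (1 / (K + 1) / 2) := by gcongr
      _ < 1 := by
        have : (0 : ℝ) ≤ K := K.2
        rw [div_div, mul_one_div, div_lt_one (by positivity)]
        linarith
  obtain ⟨η, hη, hmem, heq⟩ := exists_eq_integral_of_lipschitzOnWith hab hρ.le hK hC hw hCw hKw
  have hcurve := isHorizontalCurve_extChartAt_symm X (1 : G) hsub hK.continuousOn hC hab hw
    hη hmem heq
  refine ⟨_, ?_, hcurve.map (contMDiff_mul_left (I := 𝓡 n) (n := ∞) (a := x))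
    fun j y ↦ mfderiv_mul_left_mulInvariantVectorField (X j) x y⟩
  have : η a = extChartAt (𝓡 n) (1 : G) 1 := by
    rw [heq a (left_mem_Icc.2 hab)]
    simp
  simp [this]

/-- Every integrable control is realised by a horizontal curve, from any starting point. -/
theorem exists_isHorizontalCurve (X : Fin r → GroupLieAlgebra (𝓡 n) G) (x : G) {a b : ℝ}
    (hab : a ≤ b) {w : ℝ → EuclideanSpace ℝ (Fin r)} (hw : IntegrableOn w (Icc a b)) :
    ∃ γ : ℝ → G, γ a = x ∧ IsHorizontalCurve X a b γ w := by
  obtain ⟨ε, hε, H⟩ := exists_isHorizontalCurve_of_small X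
  -- Induction on the number of pieces of length `ε`: the interval is cut where the length already
  -- used is exactly `ε`.
  have key : ∀ (N : ℕ) (x : G) (a : ℝ), a ≤ b → IntegrableOn w (Icc a b) →
      ∫ t in a..b, ‖w t‖ ≤ N * ε → ∃ γ : ℝ → G, γ a = x ∧ IsHorizontalCurve X a b γ w := by
    intro N
    induction N with
    | zero => exact fun x a hab hw hle ↦ H x a b w hab hw (hle.trans (by simpa using hε.le))
    | succ N ih =>
      intro x a hab hw hle
      by_cases hsmall : ∫ t in a..b, ‖w t‖ ≤ ε
      · exact H x a b w hab hw hsmall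
      have hnw : IntegrableOn (fun t ↦ ‖w t‖) (Icc a b) := hw.norm
      have hcont : ContinuousOn (fun t ↦ ∫ s in a..t, ‖w s‖) (Icc a b) := by
        have := intervalIntegral.continuousOn_primitive_interval (a := a) (b := b)
          (f := fun t ↦ ‖w t‖) (μ := volume) (by rwa [uIcc_of_le hab])
        rwa [uIcc_of_le hab] at this
      obtain ⟨c, hc, hceq⟩ := intermediate_value_Icc hab hcont
        (show ε ∈ Icc _ _ from ⟨by simpa using hε.le, (not_le.1 hsmall).le⟩)
      simp only at hceq
      have hsum := intervalIntegral.integral_add_adjacent_intervals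
        (intervalIntegrable_of_mem_Icc hnw (left_mem_Icc.2 hab) hc)
        (intervalIntegrable_of_mem_Icc hnw hc (right_mem_Icc.2 hab))
      obtain ⟨γ₁, h1, hγ₁⟩ := H x a c w hc.1 (hw.mono_set (Icc_subset_Icc le_rfl hc.2)) hceq.le
      obtain ⟨γ₂, h2, hγ₂⟩ := ih (γ₁ c) c hc.2 (hw.mono_set (Icc_subset_Icc hc.1 le_rfl)) (by
        push_cast at hle
        linarith)
      have := hγ₁.trans hc.1 hc.2 hγ₂ h2.symm
      simp only [ite_self] at this
      exact ⟨_, by simp [hc.1, h1], this⟩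
  obtain ⟨N, hN⟩ := exists_nat_ge ((∫ t in a..b, ‖w t‖) / ε)
  exact key N x a hab hw ((div_le_iff₀ hε).1 hN)

end HorizontalODE

/-! ### Uniqueness and lifting of horizontal curves -/

section HorizontalUniqueness

variable {n r : ℕ} {G : Type*} [TopologicalSpace G] [T2Space G]
  [ChartedSpace (EuclideanSpace ℝ (Fin n)) G] [Group G] [LieGroup (𝓡 n) ∞ G]
  {X : Fin r → GroupLieAlgebra (𝓡 n) G}

/-- Near `p`, a horizontal curve read in the chart at `p` solves the controlled differential
equation. -/
theorem exists_extChartAt_eq_integral (X : Fin r → GroupLieAlgebra (𝓡 n) G) (p : G) :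
    ∃ N ∈ 𝓝 p, N ⊆ (extChartAt (𝓡 n) p).source ∧ ∀ (a b : ℝ) (γ : ℝ → G)
      (w : ℝ → EuclideanSpace ℝ (Fin r)), a ≤ b → IsHorizontalCurve X a b γ w →
      (∀ t ∈ Icc a b, γ t ∈ N) →
      IntegrableOn (fun t ↦ chartControl X p (extChartAt (𝓡 n) p (γ t)) (w t)) (Icc a b) →
      extChartAt (𝓡 n) p (γ b) = extChartAt (𝓡 n) p (γ a) +
        ∫ t in a..b, chartControl X p (extChartAt (𝓡 n) p (γ t)) (w t) := by
  -- Absolute continuity is tested on globally smooth functions, so the chart coordinates are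
  -- multiplied by a bump function. On `N` it is locally equal to one, so neither values nor
  -- derivatives change.
  obtain ⟨φ⟩ : Nonempty (SmoothBumpFunction (𝓡 n) p) := inferInstance
  have hsm : ContMDiff (𝓡 n) 𝓘(ℝ, EuclideanSpace ℝ (Fin n)) ∞
      (fun x ↦ φ x • extChartAt (𝓡 n) p x) := φ.contMDiff_smul (contMDiffOn_extChartAt)
  have hev : ∀ᶠ x in 𝓝 p, φ =ᶠ[𝓝 x] 1 := eventually_eventually_nhds.2 φ.eventuallyEq_one
  refine ⟨_, inter_mem hev (extChartAt_source_mem_nhds (I := 𝓡 n) p), inter_subset_right,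
    fun a b γ w hab hγ hN hint ↦ ?_⟩
  have hone : ∀ t ∈ Icc a b, φ (γ t) = 1 := fun t ht ↦ (hN t ht).1.eq_of_nhds
  ext k
  have hk : ContMDiff (𝓡 n) 𝓘(ℝ) ∞ (fun x ↦ (φ x • extChartAt (𝓡 n) p x) k) :=
    (EuclideanSpace.proj k : EuclideanSpace ℝ (Fin n) →L[ℝ] ℝ).contMDiff.comp hsm
  have hderiv : ∀ t ∈ Icc a b, ∀ V : (x : G) → TangentSpace (𝓡 n) x,
      (mfderiv (𝓡 n) 𝓘(ℝ) (fun x ↦ (φ x • extChartAt (𝓡 n) p x) k) (γ t) (V (γ t)) : ℝ) =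
        chartVectorField p V (extChartAt (𝓡 n) p (γ t)) k := by
    intro t ht V
    have e1 : (fun x ↦ (φ x • extChartAt (𝓡 n) p x) k) =ᶠ[𝓝 (γ t)]
        (EuclideanSpace.proj k : EuclideanSpace ℝ (Fin n) →L[ℝ] ℝ) ∘ extChartAt (𝓡 n) p := by
      filter_upwards [(hN t ht).1] with x hx
      simp [hx]
    rw [e1.mfderiv_eq, mfderiv_comp (I' := 𝓘(ℝ, EuclideanSpace ℝ (Fin n))) (γ t)
      (EuclideanSpace.proj k : EuclideanSpace ℝ (Fin n) →L[ℝ] ℝ).mdifferentiableAt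
      ((contMDiffAt_extChartAt_of_mem (hN t ht).2).mdifferentiableAt (by simp))]
    change (mfderiv 𝓘(ℝ, EuclideanSpace ℝ (Fin n)) 𝓘(ℝ)
      (EuclideanSpace.proj k : EuclideanSpace ℝ (Fin n) →L[ℝ] ℝ) (extChartAt (𝓡 n) p (γ t)))
      (mfderiv (𝓡 n) 𝓘(ℝ, EuclideanSpace ℝ (Fin n)) (extChartAt (𝓡 n) p) (γ t) (V (γ t))) = _
    rw [mfderiv_extChartAt_apply (hN t ht).2, ContinuousLinearMap.mfderiv_eq]
    rfl
  have hftc := (hγ.integral_eq_sub hab hk).2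
  rw [hone b (right_mem_Icc.2 hab), hone a (left_mem_Icc.2 hab), one_smul, one_smul] at hftc
  have hcomm : (∫ t in a..b, chartControl X p (extChartAt (𝓡 n) p (γ t)) (w t)) k =
      ∫ t in a..b, (chartControl X p (extChartAt (𝓡 n) p (γ t)) (w t)) k :=
    ((EuclideanSpace.proj k : EuclideanSpace ℝ (Fin n) →L[ℝ] ℝ).intervalIntegral_comp_comm
      (intervalIntegrable_of_mem_Icc hint (left_mem_Icc.2 hab) (right_mem_Icc.2 hab))).symm
  rw [PiLp.add_apply, hcomm, ← sub_eq_iff_eq_add', ← hftc]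
  refine intervalIntegral.integral_congr fun t ht ↦ ?_
  rw [uIcc_of_le hab] at ht
  simp only [chartControl_apply, PiLp.smul_apply, WithLp.ofLp_sum, Finset.sum_apply, smul_eq_mul]
  refine Finset.sum_congr rfl fun j _ ↦ ?_
  rw [← hderiv t ht]
  rfl

/-- A horizontal curve is determined by its starting point and its controls. -/
theorem IsHorizontalCurve.eqOn {a b : ℝ} {γ₁ γ₂ : ℝ → G} {w : ℝ → EuclideanSpace ℝ (Fin r)}
    (h₁ : IsHorizontalCurve X a b γ₁ w) (h₂ : IsHorizontalCurve X a b γ₂ w)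
    (h : γ₁ a = γ₂ a) : EqOn γ₁ γ₂ (Icc a b) := by
  have hclosed : IsClosed ({t | γ₁ t = γ₂ t} ∩ Icc a b) := by
    rw [inter_comm]
    exact (h₁.1.1.prodMk h₂.1.1).preimage_isClosed_of_isClosed isClosed_Icc isClosed_diagonal
  -- Continuous induction: the agreement set is closed and contains `a`, and local uniqueness in the
  -- chart at `γ₁ x` produces agreement points to the right of `x`.
  refine hclosed.Icc_subset_of_forall_exists_gt h fun x hx y hy ↦ ?_
  obtain ⟨hxe, hx⟩ := hx
  have hxb : x ∈ Icc a b := ⟨hx.1, hx.2.le⟩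
  have hw := h₁.2.1
  have hnw : IntegrableOn (fun t ↦ ‖w t‖) (Icc a b) := hw.norm
  set p := γ₁ x with hp
  obtain ⟨ρ, K, C, hρ, -, hsub, hK, hC⟩ := exists_lipschitzOnWith_chartControl X p
  obtain ⟨N, hN, hNs, hNeq⟩ := exists_extChartAt_eq_integral X p
  have hgood : N ∩ extChartAt (𝓡 n) p ⁻¹' closedBall (extChartAt (𝓡 n) p p) ρ ∈ 𝓝 p :=
    inter_mem hN ((continuousAt_extChartAt p).preimage_mem_nhds (closedBall_mem_nhds _ hρ))
  have hmemIcc : Icc a b ∈ 𝓝[>] x :=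
    mem_of_superset (Ioc_mem_nhdsGT hx.2) fun t ht ↦ ⟨hx.1.trans ht.1.le, ht.2⟩
  have hright : 𝓝[>] x ≤ 𝓝[Icc a b] x := by
    refine nhdsWithin_le_iff.2 hmemIcc
  have e₁ : ∀ᶠ t in 𝓝[>] x, γ₁ t ∈
      N ∩ extChartAt (𝓡 n) p ⁻¹' closedBall (extChartAt (𝓡 n) p p) ρ :=
    ((h₁.1.1 x hxb).mono_left hright).eventually hgood
  have e₂ : ∀ᶠ t in 𝓝[>] x, γ₂ t ∈
      N ∩ extChartAt (𝓡 n) p ⁻¹' closedBall (extChartAt (𝓡 n) p p) ρ := by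
    refine ((h₂.1.1 x hxb).mono_left hright).eventually ?_
    rw [← show γ₁ x = γ₂ x from hxe]
    exact hgood
  have e₃ : ∀ᶠ t in 𝓝[>] x, K * ∫ s in x..t, ‖w s‖ < 1 := by
    have hcont : ContinuousOn (fun t ↦ K * ∫ s in x..t, ‖w s‖) (Icc x b) := by
      have := intervalIntegral.continuousOn_primitive_interval (a := x) (b := b)
        (f := fun t ↦ ‖w t‖) (μ := volume)
        (by rw [uIcc_of_le hxb.2]; exact hnw.mono_set (Icc_subset_Icc hx.1 le_rfl))
      rw [uIcc_of_le hxb.2] at this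
      exact this.const_mul _
    have h0 := (hcont x (left_mem_Icc.2 hxb.2)).mono_left
      (nhdsWithin_le_iff.2 (mem_of_superset (Ioc_mem_nhdsGT hx.2) Ioc_subset_Icc_self))
    exact h0.eventually_lt_const (by simp)
  obtain ⟨z, hz, hzs⟩ := (mem_nhdsGT_iff_exists_Ioo_subset).1 (e₁.and e₂)
  obtain ⟨t, ht₃, htb, hty, htz⟩ := (e₃.and (inter_mem (Ioc_mem_nhdsGT hx.2)
    (inter_mem (Ioc_mem_nhdsGT (mem_Ioi.1 hy)) (Ioo_mem_nhdsGT (mem_Ioi.1 hz))))).exists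
  refine ⟨t, ?_, hty⟩
  have hgood' : ∀ s ∈ Icc x t, (γ₁ s ∈ N ∩ extChartAt (𝓡 n) p ⁻¹'
      closedBall (extChartAt (𝓡 n) p p) ρ) ∧ γ₂ s ∈ N ∩ extChartAt (𝓡 n) p ⁻¹'
      closedBall (extChartAt (𝓡 n) p p) ρ := by
    intro s hs
    rcases hs.1.eq_or_lt with rfl | hlt
    · rw [← show γ₁ x = γ₂ x from hxe]
      exact ⟨mem_of_mem_nhds hgood, mem_of_mem_nhds hgood⟩
    · exact hzs ⟨hlt, hs.2.trans_lt htz.2⟩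
  have hxt : x ≤ t := htb.1.le
  have hwt : IntegrableOn w (Icc x t) := hw.mono_set (Icc_subset_Icc hx.1 htb.2)
  have main : ∀ γ : ℝ → G, IsHorizontalCurve X a b γ w → γ x = p →
      (∀ s ∈ Icc x t, γ s ∈ N ∩ extChartAt (𝓡 n) p ⁻¹' closedBall (extChartAt (𝓡 n) p p) ρ) →
      ContinuousOn (fun s ↦ extChartAt (𝓡 n) p (γ s)) (Icc x t) ∧
      ∀ s ∈ Icc x t, extChartAt (𝓡 n) p (γ s) = extChartAt (𝓡 n) p p +
        ∫ q in x..s, chartControl X p (extChartAt (𝓡 n) p (γ q)) (w q) := by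
    intro γ hγ hγx hmem
    have hc : ContinuousOn (fun s ↦ extChartAt (𝓡 n) p (γ s)) (Icc x t) :=
      (continuousOn_extChartAt p).comp (hγ.1.1.mono (Icc_subset_Icc hx.1 htb.2))
        fun s hs ↦ hNs (hmem s hs).1
    refine ⟨hc, fun s hs ↦ ?_⟩
    have hint : IntegrableOn (fun q ↦ chartControl X p (extChartAt (𝓡 n) p (γ q)) (w q))
        (Icc x t) := integrableOn_clm_apply (hK.continuousOn.comp hc fun q hq ↦ (hmem q hq).2)
          (fun q hq ↦ hC _ (hmem q hq).2) hwt
    have := hNeq x s γ w hs.1 (hγ.mono hs.1 hx.1 (hs.2.trans htb.2))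
      (fun q hq ↦ (hmem q ⟨hq.1, hq.2.trans hs.2⟩).1)
      (hint.mono_set (Icc_subset_Icc le_rfl hs.2))
    rwa [hγx] at this
  have m₁ := main γ₁ h₁ rfl fun s hs ↦ (hgood' s hs).1
  have m₂ := main γ₂ h₂ (Eq.symm hxe) fun s hs ↦ (hgood' s hs).2
  have heq := eqOn_of_eq_integral_of_lipschitzOnWith hK hC hwt ht₃ m₁.1 m₂.1
    (fun s hs ↦ (hgood' s hs).1.2) (fun s hs ↦ (hgood' s hs).2.2) m₁.2 m₂.2
    (right_mem_Icc.2 hxt)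
  have hgt := hgood' t (right_mem_Icc.2 hxt)
  exact (extChartAt (𝓡 n) p).injOn (hNs hgt.1.1) (hNs hgt.2.1) heq

/-- Lifting of horizontal curves along a homomorphism mapping the frame `X` to the frame `Y`. -/
theorem exists_lift_ccEDist {m : ℕ} {K : Type*} [TopologicalSpace K]
    [ChartedSpace (EuclideanSpace ℝ (Fin m)) K] [Group K] [LieGroup (𝓡 m) ∞ K]
    {Y : Fin r → GroupLieAlgebra (𝓡 m) K} {Φ : K → G} (hΦ : ContMDiff (𝓡 m) (𝓡 n) ∞ Φ)
    (hYX : ∀ j x, mfderiv (𝓡 m) (𝓡 n) Φ x (mulInvariantVectorField (Y j) x) =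
      mulInvariantVectorField (X j) (Φ x)) (x : K) {y : G} {ℓ : ℝ≥0∞}
    (h : ccEDist X (Φ x) y < ℓ) : ∃ z : K, Φ z = y ∧ ccEDist Y x z < ℓ := by
  obtain ⟨a, b, γ, u, hab, hγ, hx, rfl, hlt⟩ := exists_isHorizontalCurve_of_ccEDist_lt h
  -- The lift is the curve from `x` with the controls of `γ`; its image has the same controls and
  -- starting point as `γ`, hence is `γ`.
  obtain ⟨γ', rfl, hγ'⟩ := exists_isHorizontalCurve Y x hab hγ.2.1
  exact ⟨γ' b, (hγ'.map hΦ hYX).eqOn hγ hx.symm (right_mem_Icc.2 hab),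
    (ccEDist_le hγ' hab).trans_lt hlt⟩

end HorizontalUniqueness

/-! ### Closed left invariant 1-forms near the identity -/

section LeftInvariantForms

open VectorField

variable {n : ℕ} {G : Type*} [TopologicalSpace G] [ChartedSpace (EuclideanSpace ℝ (Fin n)) G]
  [Group G]

theorem mulInvariantVectorField_one (v : GroupLieAlgebra (𝓡 n) G) :
    mulInvariantVectorField v (1 : G) = v := by
  have h1 : mfderiv (𝓡 n) (𝓡 n) (fun y : G ↦ 1 * y) 1 =
      ContinuousLinearMap.id ℝ (EuclideanSpace ℝ (Fin n)) := by
    have : (fun y : G ↦ 1 * y) = id := by ext; simp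
    rw [this]
    exact mfderiv_id
  exact congrArg (fun A : EuclideanSpace ℝ (Fin n) →L[ℝ] EuclideanSpace ℝ (Fin n) ↦ A v) h1

theorem mulInvariantVectorField_eq_of_eq_one (v : GroupLieAlgebra (𝓡 n) G) {x : G} (hx : x = 1) :
    (mulInvariantVectorField v x : EuclideanSpace ℝ (Fin n)) = v := by
  subst hx
  exact mulInvariantVectorField_one v

variable [LieGroup (𝓡 n) ∞ G]

theorem exists_mulInvariantVectorField_eq (x : G) (a : TangentSpace (𝓡 n) x) :
    ∃ v : GroupLieAlgebra (𝓡 n) G, mulInvariantVectorField v x = a := by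
  let B : EuclideanSpace ℝ (Fin n) →L[ℝ] EuclideanSpace ℝ (Fin n) :=
    mfderiv (𝓡 n) (𝓡 n) (fun y : G ↦ x * y) 1
  let A : EuclideanSpace ℝ (Fin n) →L[ℝ] EuclideanSpace ℝ (Fin n) :=
    mfderiv (𝓡 n) (𝓡 n) (fun y : G ↦ x⁻¹ * y) x
  have hAB : ∀ v, A (B v) = v := fun v ↦
    (mfderiv_mul_left_mulInvariantVectorField (n := n) (G := G) v x⁻¹ x).trans
      (mulInvariantVectorField_eq_of_eq_one v (inv_mul_cancel x))
  have hinj : Function.Injective (B : EuclideanSpace ℝ (Fin n) →ₗ[ℝ] EuclideanSpace ℝ (Fin n)) :=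
    Function.LeftInverse.injective (g := A) hAB
  exact (LinearMap.injective_iff_surjective.1 hinj) a

/-- The Maurer-Cartan form read in the chart at the identity. -/
noncomputable def chartMaurerCartan (G : Type*) [TopologicalSpace G]
    [ChartedSpace (EuclideanSpace ℝ (Fin n)) G] [Group G] (y : EuclideanSpace ℝ (Fin n)) :
    EuclideanSpace ℝ (Fin n) →L[ℝ] EuclideanSpace ℝ (Fin n) :=
  fderiv ℝ (fun z ↦ extChartAt (𝓡 n) (1 : G)
    (((extChartAt (𝓡 n) (1 : G)).symm y)⁻¹ * (extChartAt (𝓡 n) (1 : G)).symm z)) y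

/-- The form is a partial derivative, taken on the diagonal, of a smooth function of two variables.
-/
theorem contDiffAt_chartMaurerCartan {y : EuclideanSpace ℝ (Fin n)}
    (hy : y ∈ (extChartAt (𝓡 n) (1 : G)).target) : ContDiffAt ℝ ∞ (chartMaurerCartan G) y := by
  have h : ContMDiffAt (𝓘(ℝ, EuclideanSpace ℝ (Fin n)).prod 𝓘(ℝ, EuclideanSpace ℝ (Fin n)))
      𝓘(ℝ, EuclideanSpace ℝ (Fin n)) ∞
      (fun q : EuclideanSpace ℝ (Fin n) × EuclideanSpace ℝ (Fin n) ↦ extChartAt (𝓡 n) (1 : G)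
        (((extChartAt (𝓡 n) (1 : G)).symm q.1)⁻¹ * (extChartAt (𝓡 n) (1 : G)).symm q.2))
      (y, y) := by
    have hs := contMDiffAt_extChartAt_symm_of_mem hy
    have h1 : ContMDiffAt (𝓘(ℝ, EuclideanSpace ℝ (Fin n)).prod 𝓘(ℝ, EuclideanSpace ℝ (Fin n)))
        (𝓡 n) ∞ (fun q : EuclideanSpace ℝ (Fin n) × EuclideanSpace ℝ (Fin n) ↦
          ((extChartAt (𝓡 n) (1 : G)).symm q.1)⁻¹ * (extChartAt (𝓡 n) (1 : G)).symm q.2)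
        (y, y) :=
      (ContMDiffAt.comp (y, y) (g := (extChartAt (𝓡 n) (1 : G)).symm) hs contMDiffAt_fst).inv.mul
        (ContMDiffAt.comp (y, y) (g := (extChartAt (𝓡 n) (1 : G)).symm) hs contMDiffAt_snd)
    refine ContMDiffAt.comp (y, y) (g := extChartAt (𝓡 n) (1 : G)) ?_ h1
    refine contMDiffAt_extChartAt_of_mem ?_
    simp
  rw [← modelWithCornersSelf_prod, chartedSpaceSelf_prod] at h
  exact (contMDiffAt_iff_contDiffAt.1 h).fderiv contDiffAt_id (by simp)

/-- Left translation by `x⁻¹` carries the invariant field at `x` to its value at the identity, where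
the derivative of the chart is the identity map. -/
theorem chartMaurerCartan_apply {y : EuclideanSpace ℝ (Fin n)}
    (hy : y ∈ (extChartAt (𝓡 n) (1 : G)).target) (v : GroupLieAlgebra (𝓡 n) G) :
    chartMaurerCartan G y (chartVectorField (1 : G) (mulInvariantVectorField v) y) = v := by
  set x := (extChartAt (𝓡 n) (1 : G)).symm y with hx
  have hxx : x⁻¹ * x ∈ (extChartAt (𝓡 n) (1 : G)).source := by simp
  have hs := (contMDiffAt_extChartAt_symm_of_mem hy).mdifferentiableAt (by simp)
  have hm : MDifferentiableAt (𝓡 n) (𝓡 n) (fun z : G ↦ x⁻¹ * z) x :=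
    (contMDiff_mul_left (I := 𝓡 n) (n := ∞) (a := x⁻¹)).mdifferentiable (by simp) x
  have hc := (contMDiffAt_extChartAt_of_mem hxx).mdifferentiableAt (by simp)
  have h2 := (hc.hasMFDerivAt.comp x hm.hasMFDerivAt).comp y hs.hasMFDerivAt
  have h3 : ∀ D : EuclideanSpace ℝ (Fin n) →L[ℝ] EuclideanSpace ℝ (Fin n), HasFDerivAt
      (fun z ↦ extChartAt (𝓡 n) (1 : G) (x⁻¹ * (extChartAt (𝓡 n) (1 : G)).symm z)) D y →
      chartMaurerCartan G y = D := fun D hD ↦ hD.fderiv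
  rw [h3 _ h2.hasFDerivAt]
  change mfderiv (𝓡 n) 𝓘(ℝ, EuclideanSpace ℝ (Fin n)) (extChartAt (𝓡 n) (1 : G)) (x⁻¹ * x)
    (mfderiv (𝓡 n) (𝓡 n) (fun z : G ↦ x⁻¹ * z) x
      (mfderiv 𝓘(ℝ, EuclideanSpace ℝ (Fin n)) (𝓡 n) (extChartAt (𝓡 n) (1 : G)).symm y
        (chartVectorField (1 : G) (mulInvariantVectorField v) y))) = v
  rw [mfderiv_extChartAt_symm_chartVectorField hy, mfderiv_mul_left_mulInvariantVectorField,
    mfderiv_extChartAt_apply hxx, inv_mul_cancel,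
    ← mfderiv_extChartAt_apply (mem_extChartAt_source (I := 𝓡 n) (1 : G))]
  have h5 : mfderiv (𝓡 n) 𝓘(ℝ, EuclideanSpace ℝ (Fin n)) (extChartAt (𝓡 n) (1 : G)) 1 =
      ContinuousLinearMap.id ℝ (EuclideanSpace ℝ (Fin n)) := mfderiv_extChartAt_self
  rw [mulInvariantVectorField_one]
  exact congrArg (fun A : EuclideanSpace ℝ (Fin n) →L[ℝ] EuclideanSpace ℝ (Fin n) ↦ A v) h5

theorem exists_chartVectorField_eq {y : EuclideanSpace ℝ (Fin n)}
    (hy : y ∈ (extChartAt (𝓡 n) (1 : G)).target) (a : EuclideanSpace ℝ (Fin n)) :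
    ∃ v : GroupLieAlgebra (𝓡 n) G,
      chartVectorField (1 : G) (mulInvariantVectorField v) y = a := by
  have hsurj : Function.Surjective (chartMaurerCartan G y :
      EuclideanSpace ℝ (Fin n) →ₗ[ℝ] EuclideanSpace ℝ (Fin n)) := fun v ↦
    ⟨_, chartMaurerCartan_apply hy v⟩
  have hinj := LinearMap.injective_iff_surjective.2 hsurj
  exact ⟨chartMaurerCartan G y a, hinj (chartMaurerCartan_apply hy _)⟩

theorem lieBracket_chartVectorField {y : EuclideanSpace ℝ (Fin n)}
    (hy : y ∈ (extChartAt (𝓡 n) (1 : G)).target) (v w : GroupLieAlgebra (𝓡 n) G) :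
    lieBracket ℝ (chartVectorField (1 : G) (mulInvariantVectorField v))
      (chartVectorField (1 : G) (mulInvariantVectorField w)) y =
      chartVectorField (1 : G) (mulInvariantVectorField ⁅v, w⁆) y := by
  have := LieGroup.minSmoothness_three (n := n) (G := G)
  have := IsManifold.of_le (I := 𝓡 n) (M := G) (m := minSmoothness ℝ 3) (n := ∞)
    (by simpa using ENat.LEInfty.out)
  rw [GroupLieAlgebra.bracket_def, mulInvariantVector_mlieBracket]
  have h := mpullback_mlieBracket (𝕜 := ℝ) (n := ∞)
    (f := (extChartAt (𝓡 n) (1 : G)).symm) (x₀ := y)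
    (mdifferentiableAt_mulInvariantVectorField v)
    (mdifferentiableAt_mulInvariantVectorField w)
    (contMDiffAt_extChartAt_symm_of_mem hy) (by simpa using ENat.LEInfty.out)
  have h' : ∀ V W : (z : EuclideanSpace ℝ (Fin n)) →
      TangentSpace 𝓘(ℝ, EuclideanSpace ℝ (Fin n)) z,
      mlieBracket 𝓘(ℝ, EuclideanSpace ℝ (Fin n)) V W y = lieBracket ℝ V W y := fun V W ↦ by
    rw [← mlieBracketWithin_univ, mlieBracketWithin_eq_lieBracketWithin]
    exact congrFun lieBracketWithin_univ y
  exact (h.trans (h' _ _)).symm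

/-- A linear form on the Lie algebra which vanishes on brackets defines a closed left invariant
1-form. -/
theorem fderiv_chartMaurerCartan_symm {θ : EuclideanSpace ℝ (Fin n) →L[ℝ] ℝ}
    (hθ : ∀ v w : GroupLieAlgebra (𝓡 n) G, θ (⁅v, w⁆ : GroupLieAlgebra (𝓡 n) G) = 0) {y : EuclideanSpace ℝ (Fin n)}
    (hy : y ∈ (extChartAt (𝓡 n) (1 : G)).target) (a b : EuclideanSpace ℝ (Fin n)) :
    fderiv ℝ (fun y ↦ θ.comp (chartMaurerCartan G y)) y a b =
      fderiv ℝ (fun y ↦ θ.comp (chartMaurerCartan G y)) y b a := by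
  obtain ⟨v, rfl⟩ := exists_chartVectorField_eq hy a
  obtain ⟨w, rfl⟩ := exists_chartVectorField_eq hy b
  set V := chartVectorField (1 : G) (mulInvariantVectorField v)
  set W := chartVectorField (1 : G) (mulInvariantVectorField w)
  set α := fun y ↦ θ.comp (chartMaurerCartan G y)
  have hα : DifferentiableAt ℝ α y :=
    (differentiableAt_const θ).clm_comp
      ((contDiffAt_chartMaurerCartan hy).differentiableAt (by simp))
  have hdiff : ∀ v : GroupLieAlgebra (𝓡 n) G, DifferentiableAt ℝ
      (chartVectorField (1 : G) (mulInvariantVectorField v)) y := fun v ↦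
    (contDiffAt_chartVectorField hy (contMDiff_one_mulInvariantVectorField v)).differentiableAt
      (by simp)
  -- The form takes the constant value `θ v` on an invariant field; this is the derivative of that
  -- identity. Antisymmetrizing it gives `dα(V, W) = -α([V, W]) = 0`.
  have key : ∀ (v : GroupLieAlgebra (𝓡 n) G) (c : EuclideanSpace ℝ (Fin n)),
      fderiv ℝ α y c (chartVectorField (1 : G) (mulInvariantVectorField v) y) +
        α y (fderiv ℝ (chartVectorField (1 : G) (mulInvariantVectorField v)) y c) = 0 := by
    intro v c
    have h1 := (hα.hasFDerivAt.clm_apply (hdiff v).hasFDerivAt)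
    have h2 : (fun z ↦ α z (chartVectorField (1 : G) (mulInvariantVectorField v) z)) =ᶠ[𝓝 y]
        fun _ ↦ θ v := by
      filter_upwards [(isOpen_extChartAt_target (I := 𝓡 n) (1 : G)).mem_nhds hy] with z hz
      exact congrArg θ (chartMaurerCartan_apply hz v)
    have h3 := (h1.congr_of_eventuallyEq h2.symm).unique (hasFDerivAt_const (θ v) y)
    have h4 := congrArg (fun A : EuclideanSpace ℝ (Fin n) →L[ℝ] ℝ ↦ A c) h3
    simpa [add_comm] using h4
  have hb : α y (lieBracket ℝ V W y) = 0 := by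
    rw [lieBracket_chartVectorField hy]
    exact (congrArg θ (chartMaurerCartan_apply hy _)).trans (hθ v w)
  rw [lieBracket_eq, map_sub] at hb
  have h1 := key v (W y)
  have h2 := key w (V y)
  change fderiv ℝ α y (W y) (V y) + α y (fderiv ℝ V y (W y)) = 0 at h1
  change fderiv ℝ α y (V y) (W y) + α y (fderiv ℝ W y (V y)) = 0 at h2
  linarith

/-- Poincaré lemma on a ball in the chart; the primitive is smooth because its differential is. -/
theorem exists_local_primitive {θ : EuclideanSpace ℝ (Fin n) →L[ℝ] ℝ}
    (hθ : ∀ v w : GroupLieAlgebra (𝓡 n) G, θ (⁅v, w⁆ : GroupLieAlgebra (𝓡 n) G) = 0) :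
    ∃ (U : Set G) (f : G → ℝ), IsOpen U ∧ 1 ∈ U ∧ ∀ x ∈ U, ContMDiffAt (𝓡 n) 𝓘(ℝ) ∞ f x ∧
      ∀ v : GroupLieAlgebra (𝓡 n) G,
        (mfderiv (𝓡 n) 𝓘(ℝ) f x (mulInvariantVectorField v x) : ℝ) = θ v := by
  have hp := mem_extChartAt_target (I := 𝓡 n) (1 : G)
  obtain ⟨ρ, hρ, hsub⟩ := Metric.isOpen_iff.1 (isOpen_extChartAt_target (I := 𝓡 n) (1 : G)) _ hp
  set y₀ := extChartAt (𝓡 n) (1 : G) 1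
  have hsm : ContDiffOn ℝ ∞ (fun y ↦ θ.comp (chartMaurerCartan G y)) (ball y₀ ρ) := fun y hy ↦
    (contDiffAt_const.clm_comp (contDiffAt_chartMaurerCartan (hsub hy))).contDiffWithinAt
  obtain ⟨f, hf⟩ := (convex_ball y₀ ρ).exists_forall_hasFDerivAt_of_fderiv_symmetric isOpen_ball
    (hsm.differentiableOn (by simp)) fun y hy a b ↦ fderiv_chartMaurerCartan_symm hθ (hsub hy) a b
  have hfs : ContDiffOn ℝ ∞ f (ball y₀ ρ) := by
    rw [contDiffOn_infty_iff_fderiv_of_isOpen isOpen_ball]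
    exact ⟨fun y hy ↦ (hf y hy).differentiableAt.differentiableWithinAt,
      hsm.congr fun y hy ↦ (hf y hy).fderiv⟩
  refine ⟨(extChartAt (𝓡 n) (1 : G)).source ∩ extChartAt (𝓡 n) (1 : G) ⁻¹' ball y₀ ρ,
    f ∘ extChartAt (𝓡 n) (1 : G), isOpen_extChartAt_preimage' _ isOpen_ball,
    ⟨mem_extChartAt_source _, mem_ball_self hρ⟩, fun x hx ↦ ⟨?_, fun v ↦ ?_⟩⟩
  · exact ((hfs.contDiffAt (isOpen_ball.mem_nhds hx.2)).contMDiffAt).comp x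
      (contMDiffAt_extChartAt_of_mem hx.1)
  · have h1 := (hf _ hx.2).hasMFDerivAt.comp x
      ((contMDiffAt_extChartAt_of_mem hx.1).mdifferentiableAt (by simp)).hasMFDerivAt
    rw [h1.mfderiv]
    change θ (chartMaurerCartan G (extChartAt (𝓡 n) (1 : G) x)
      (mfderiv (𝓡 n) 𝓘(ℝ, EuclideanSpace ℝ (Fin n)) (extChartAt (𝓡 n) (1 : G)) x
        (mulInvariantVectorField v x))) = θ v
    rw [mfderiv_extChartAt_apply hx.1]
    exact congrArg θ (chartMaurerCartan_apply (hsub hx.2) v)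

end LeftInvariantForms

/-! ### Locally constant cocycles on simply connected spaces -/

section Cocycles

/-- On a simply connected space, a locally constant cocycle with values in an abelian group is a
coboundary. -/
theorem exists_coboundary_of_locallyConstant_cocycle {B D : Type*} [TopologicalSpace B]
    [SimplyConnectedSpace B] [LocallyPathConnectedSpace B] [AddCommGroup D]
    (U : B → Set B) (hU : ∀ i, IsOpen (U i)) (hmem : ∀ x, x ∈ U x) (c : B → B → B → D)
    (hloc : ∀ i j, ∀ x ∈ U i ∩ U j, ∀ᶠ y in 𝓝 x, c i j y = c i j x)
    (hself : ∀ i, ∀ x ∈ U i, c i i x = 0)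
    (hcomp : ∀ i j k, ∀ x ∈ U i ∩ U j ∩ U k, c i j x + c j k x = c i k x) :
    ∃ s : B → B → D, (∀ i, ∀ x ∈ U i, ∀ᶠ y in 𝓝 x, s i y = s i x) ∧
      ∀ i j, ∀ x ∈ U i ∩ U j, s j x = s i x + c i j x := by
  let tD : TopologicalSpace D := ⊥
  have : DiscreteTopology D := ⟨rfl⟩
  -- The cocycle glues the sets `U i × D`, with `D` discrete, into a covering of `B`. Simple
  -- connectedness gives a global section, and `s i` is that section in the `i`-th trivialization.
  let Z : FiberBundleCore B B D :=
    { baseSet := U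
      isOpen_baseSet := hU
      indexAt := id
      mem_baseSet_at := hmem
      coordChange := fun i j x v ↦ v + c i j x
      coordChange_self := fun i x hx v ↦ by rw [hself i x hx, add_zero]
      continuousOn_coordChange := fun i j ↦ by
        rintro ⟨x, v⟩ ⟨hx, -⟩
        refine ContinuousAt.continuousWithinAt ?_
        have h1 : ∀ᶠ q : B × D in 𝓝 (x, v), q.2 + c i j q.1 = v + c i j x := by
          rw [nhds_prod_eq, nhds_discrete D]
          filter_upwards [(hloc i j x hx).prod_mk (show ∀ᶠ w in pure v, w = v by simp)] with q hq
          rw [hq.1, hq.2]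
        exact (continuousAt_const (y := v + c i j x)).congr (h1.mono fun q hq ↦ hq.symm)
      coordChange_comp := fun i j k x hx v ↦ by rw [add_assoc, hcomp i j k x hx] }
  have hcov : IsCoveringMap Z.proj := IsFiberBundle.isCoveringMap (F := D) fun x ↦
    ⟨Z.localTriv x, hmem x⟩
  have hne : Nonempty B := inferInstance
  obtain ⟨x₀⟩ := hne
  obtain ⟨σ, ⟨-, hσ⟩, -⟩ := hcov.existsUnique_continuousMap_lifts (ContinuousMap.id B) x₀
    (⟨x₀, (0 : D)⟩ : Z.TotalSpace) rfl
  have hσ' : ∀ x, (σ x).1 = x := fun x ↦ congrFun hσ x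
  refine ⟨fun i x ↦ (Z.localTriv i (σ x)).2, fun i x hx ↦ ?_, fun i j x hx ↦ ?_⟩
  · have hcont : ContinuousAt (fun y ↦ (Z.localTriv i (σ y)).2) x := by
      have h1 : ContinuousAt (Z.localTriv i) (σ x) :=
        (Z.localTriv i).continuousAt ((Z.mem_localTriv_source i _).2 (by rw [hσ' x]; exact hx))
      exact continuousAt_snd.comp (h1.comp (σ.continuous.continuousAt))
    have := hcont.eventually (show ∀ᶠ w in 𝓝 (Z.localTriv i (σ x)).2,
      w = (Z.localTriv i (σ x)).2 by rw [nhds_discrete D]; simp)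
    exact this
  · have h1 := Z.coordChange_comp (Z.indexAt (σ x).1) i j (σ x).1
      ⟨⟨Z.mem_baseSet_at _, by rw [hσ' x]; exact hx.1⟩, by rw [hσ' x]; exact hx.2⟩ (σ x).2
    simp only [FiberBundleCore.localTriv_apply]
    rw [← h1]
    change _ + c i j (σ x).1 = _
    rw [hσ' x]

end Cocycles

/-! ### Global primitives and homomorphisms to the reals -/

section Primitive

variable {n : ℕ} {G : Type*} [TopologicalSpace G] [ChartedSpace (EuclideanSpace ℝ (Fin n)) G]

theorem eventually_eq_of_mfderiv_eq_zero [IsManifold (𝓡 n) ∞ G] {f : G → ℝ} {x : G}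
    (hf : ∀ᶠ y in 𝓝 x, MDifferentiableAt (𝓡 n) 𝓘(ℝ) f y ∧ mfderiv (𝓡 n) 𝓘(ℝ) f y = 0) :
    ∀ᶠ y in 𝓝 x, f y = f x := by
  have hx := mem_extChartAt_target (I := 𝓡 n) x
  have hcs : ContinuousAt (extChartAt (𝓡 n) x).symm (extChartAt (𝓡 n) x x) :=
    continuousAt_extChartAt_symm x
  have hev : ∀ᶠ z in 𝓝 (extChartAt (𝓡 n) x x), z ∈ (extChartAt (𝓡 n) x).target ∧
      (MDifferentiableAt (𝓡 n) 𝓘(ℝ) f ((extChartAt (𝓡 n) x).symm z) ∧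
        mfderiv (𝓡 n) 𝓘(ℝ) f ((extChartAt (𝓡 n) x).symm z) = 0) := by
    rw [ContinuousAt, extChartAt_to_inv] at hcs
    exact Filter.Eventually.and ((isOpen_extChartAt_target x).mem_nhds hx) (hcs.eventually
      (p := fun y ↦ MDifferentiableAt (𝓡 n) 𝓘(ℝ) f y ∧ mfderiv (𝓡 n) 𝓘(ℝ) f y = 0) hf)
  obtain ⟨ρ, hρ, hsub⟩ := Metric.nhds_basis_ball.eventually_iff.1 hev
  have hd : ∀ z ∈ ball (extChartAt (𝓡 n) x x) ρ,
      HasFDerivAt (f ∘ (extChartAt (𝓡 n) x).symm) (0 : EuclideanSpace ℝ (Fin n) →L[ℝ] ℝ) z := by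
    intro z hz
    obtain ⟨h1, h2, h3⟩ := hsub hz
    have h4 := h2.hasMFDerivAt.comp z
      ((contMDiffAt_extChartAt_symm_of_mem h1).mdifferentiableAt (by simp)).hasMFDerivAt
    rw [h3, ContinuousLinearMap.zero_comp] at h4
    exact h4.hasFDerivAt
  have hconst : ∀ z ∈ ball (extChartAt (𝓡 n) x x) ρ,
      (f ∘ (extChartAt (𝓡 n) x).symm) z = f x := by
    intro z hz
    have := (convex_ball (extChartAt (𝓡 n) x x) ρ).is_const_of_fderivWithin_eq_zero (𝕜 := ℝ)
      (f := f ∘ (extChartAt (𝓡 n) x).symm)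
      (fun y hy ↦ (hd y hy).differentiableAt.differentiableWithinAt)
      (fun y hy ↦ (hd y hy).hasFDerivWithinAt.fderivWithin
        (isOpen_ball.uniqueDiffWithinAt hy)) hz (mem_ball_self hρ)
    rw [this, Function.comp_apply, extChartAt_to_inv]
  filter_upwards [extChartAt_source_mem_nhds (I := 𝓡 n) x,
    (continuousAt_extChartAt (I := 𝓡 n) x).preimage_mem_nhds (ball_mem_nhds _ hρ)] with y hy1 hy2
  rw [← hconst _ hy2, Function.comp_apply, (extChartAt (𝓡 n) x).left_inv hy1]

variable [Group G] [LieGroup (𝓡 n) ∞ G]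

theorem eventually_sub_eq_of_mfderiv_eq {f g : G → ℝ} {x : G}
    (hfg : ∀ᶠ y in 𝓝 x, MDifferentiableAt (𝓡 n) 𝓘(ℝ) f y ∧ MDifferentiableAt (𝓡 n) 𝓘(ℝ) g y ∧
      ∀ v : GroupLieAlgebra (𝓡 n) G,
        (mfderiv (𝓡 n) 𝓘(ℝ) f y (mulInvariantVectorField v y) : ℝ) =
          mfderiv (𝓡 n) 𝓘(ℝ) g y (mulInvariantVectorField v y)) :
    ∀ᶠ y in 𝓝 x, f y - g y = f x - g x := by
  refine eventually_eq_of_mfderiv_eq_zero (n := n) (f := fun y ↦ f y - g y) ?_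
  filter_upwards [hfg] with y hy
  obtain ⟨h1, h2, h3⟩ := hy
  have h4 := h1.hasMFDerivAt.sub h2.hasMFDerivAt
  refine ⟨h4.mdifferentiableAt, h4.mfderiv.trans ?_⟩
  refine ContinuousLinearMap.ext fun a ↦ ?_
  obtain ⟨v, rfl⟩ := exists_mulInvariantVectorField_eq (n := n) y a
  exact sub_eq_zero.2 (h3 v)

/-- On a simply connected Lie group, a linear form on the Lie algebra which vanishes on brackets
is the differential of a smooth function. -/
theorem exists_primitive [SimplyConnectedSpace G] {θ : EuclideanSpace ℝ (Fin n) →L[ℝ] ℝ}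
    (hθ : ∀ v w : GroupLieAlgebra (𝓡 n) G, θ (⁅v, w⁆ : GroupLieAlgebra (𝓡 n) G) = 0) :
    ∃ L : G → ℝ, ContMDiff (𝓡 n) 𝓘(ℝ) ∞ L ∧ ∀ (x : G) (v : GroupLieAlgebra (𝓡 n) G),
      (mfderiv (𝓡 n) 𝓘(ℝ) L x (mulInvariantVectorField v x) : ℝ) = θ v := by
  have := ChartedSpace.locallyPathConnectedSpace (EuclideanSpace ℝ (Fin n)) G
  obtain ⟨U, f, hU, h1U, hf⟩ := exists_local_primitive (G := G) hθ
  have hcm : ∀ p : G, ContMDiff (𝓡 n) (𝓡 n) ∞ (fun x : G ↦ p⁻¹ * x) := fun p ↦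
    contMDiff_mul_left (I := 𝓡 n) (n := ∞) (a := p⁻¹)
  -- By left invariance the translates of one local primitive are local primitives everywhere; their
  -- differences form a locally constant cocycle.
  let Up : G → Set G := fun p ↦ (fun x ↦ p⁻¹ * x) ⁻¹' U
  let fp : G → G → ℝ := fun p x ↦ f (p⁻¹ * x)
  have hUp : ∀ p, IsOpen (Up p) := fun p ↦ hU.preimage (hcm p).continuous
  have hmem : ∀ p, p ∈ Up p := fun p ↦ by simpa [Up] using h1U
  have hfp : ∀ p, ∀ x ∈ Up p, ContMDiffAt (𝓡 n) 𝓘(ℝ) ∞ (fp p) x ∧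
      ∀ v : GroupLieAlgebra (𝓡 n) G,
        (mfderiv (𝓡 n) 𝓘(ℝ) (fp p) x (mulInvariantVectorField v x) : ℝ) = θ v := by
    intro p x hx
    obtain ⟨h1, h2⟩ := hf _ hx
    refine ⟨h1.comp x (hcm p).contMDiffAt, fun v ↦ ?_⟩
    have h3 := (h1.mdifferentiableAt (by simp)).hasMFDerivAt.comp x
      ((hcm p).mdifferentiable (by simp) x).hasMFDerivAt
    have h4 : mfderiv (𝓡 n) 𝓘(ℝ) (fp p) x = _ := h3.mfderiv
    rw [h4]
    change mfderiv (𝓡 n) 𝓘(ℝ) f (p⁻¹ * x) (mfderiv (𝓡 n) (𝓡 n) (fun x : G ↦ p⁻¹ * x) x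
      (mulInvariantVectorField v x)) = θ v
    rw [mfderiv_mul_left_mulInvariantVectorField]
    exact h2 v
  obtain ⟨s, hs, hsc⟩ := exists_coboundary_of_locallyConstant_cocycle Up hUp hmem
    (fun i j x ↦ fp j x - fp i x)
    (fun i j x hx ↦ by
      refine eventually_sub_eq_of_mfderiv_eq (n := n) ?_
      filter_upwards [(hUp i).mem_nhds hx.1, (hUp j).mem_nhds hx.2] with y hy1 hy2
      exact ⟨(hfp j y hy2).1.mdifferentiableAt (by simp),
        (hfp i y hy1).1.mdifferentiableAt (by simp), fun v ↦
        ((hfp j y hy2).2 v).trans ((hfp i y hy1).2 v).symm⟩)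
    (fun i x _ ↦ sub_self _) (fun i j k x _ ↦ by ring)
  -- The coboundary relation removes the dependence on the index, so near `x` the glued function is
  -- a fixed local primitive up to a constant.
  have hL : ∀ x, (fun y ↦ fp y y - s y y) =ᶠ[𝓝 x] fun y ↦ fp x y - s x x := by
    intro x
    filter_upwards [(hUp x).mem_nhds (hmem x), hs x x (hmem x)] with y hy1 hy2
    rw [hsc x y y ⟨hy1, hmem y⟩, hy2]
    ring
  have hLs : ∀ x, ContMDiffAt (𝓡 n) 𝓘(ℝ) ∞ (fun y ↦ fp x y - s x x) x := fun x ↦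
    (hfp x x (hmem x)).1.sub contMDiffAt_const
  refine ⟨fun y ↦ fp y y - s y y, fun x ↦ (hLs x).congr_of_eventuallyEq (hL x), fun x v ↦ ?_⟩
  rw [(hL x).mfderiv_eq]
  have h1 := ((hfp x x (hmem x)).1.mdifferentiableAt (by simp)).hasMFDerivAt.sub
    (hasMFDerivAt_const (I := 𝓡 n) (I' := 𝓘(ℝ)) (s x x) x)
  have h2 : mfderiv (𝓡 n) 𝓘(ℝ) (fun y ↦ fp x y - s x x) x = _ := h1.mfderiv
  rw [h2]
  refine Eq.trans ?_ ((hfp x x (hmem x)).2 v)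
  exact sub_zero _

/-- On a simply connected Lie group, a linear form on the Lie algebra which vanishes on brackets
is the differential of a smooth homomorphism to the real numbers. -/
theorem exists_hom_of_linearForm [SimplyConnectedSpace G]
    {θ : EuclideanSpace ℝ (Fin n) →L[ℝ] ℝ}
    (hθ : ∀ v w : GroupLieAlgebra (𝓡 n) G, θ (⁅v, w⁆ : GroupLieAlgebra (𝓡 n) G) = 0) :
    ∃ L : G → ℝ, ContMDiff (𝓡 n) 𝓘(ℝ) ∞ L ∧ (∀ x y, L (x * y) = L x + L y) ∧
      ∀ (x : G) (v : GroupLieAlgebra (𝓡 n) G),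
        (mfderiv (𝓡 n) 𝓘(ℝ) L x (mulInvariantVectorField v x) : ℝ) = θ v := by
  obtain ⟨f, hf, hdf⟩ := exists_primitive (G := G) hθ
  -- By left invariance `y ↦ f (x * y) - f y` has zero differential, so it is constant on the
  -- connected group.
  have hmul : ∀ x y, f (x * y) - f y = f x - f 1 := by
    intro x
    have hcm : ContMDiff (𝓡 n) (𝓡 n) ∞ (fun y : G ↦ x * y) :=
      contMDiff_mul_left (I := 𝓡 n) (n := ∞) (a := x)
    have hloc : IsLocallyConstant (fun y ↦ f (x * y) - f y) := by
      rw [IsLocallyConstant.iff_eventually_eq]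
      intro y
      refine eventually_sub_eq_of_mfderiv_eq (n := n) (f := fun y ↦ f (x * y))
        (Eventually.of_forall fun z ↦ ⟨(hf.comp hcm).mdifferentiable (by simp) z,
          hf.mdifferentiable (by simp) z, fun v ↦ ?_⟩)
      have h3 := (hf.mdifferentiable (by simp) (x * z)).hasMFDerivAt.comp z
        (hcm.mdifferentiable (by simp) z).hasMFDerivAt
      have h4 : mfderiv (𝓡 n) 𝓘(ℝ) (fun y ↦ f (x * y)) z = _ := h3.mfderiv
      rw [h4]
      change mfderiv (𝓡 n) 𝓘(ℝ) f (x * z) (mfderiv (𝓡 n) (𝓡 n) (fun y : G ↦ x * y) z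
        (mulInvariantVectorField v z)) = _
      rw [mfderiv_mul_left_mulInvariantVectorField]
      exact (hdf _ v).trans (hdf _ v).symm
    intro y
    have h := hloc.apply_eq_of_preconnectedSpace y 1
    simpa using h
  refine ⟨fun x ↦ f x - f 1, hf.sub contMDiff_const, fun x y ↦ ?_, fun x v ↦ ?_⟩
  · linarith [hmul x y]
  · have h1 := (hf.mdifferentiable (by simp) x).hasMFDerivAt.sub
      (hasMFDerivAt_const (I := 𝓡 n) (I' := 𝓘(ℝ)) (f 1) x)
    have h2 : mfderiv (𝓡 n) 𝓘(ℝ) (fun y ↦ f y - f 1) x = _ := h1.mfderiv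
    rw [h2]
    refine Eq.trans ?_ (hdf x v)
    exact sub_zero _

end Primitive

/-! ### The exponential map and calibrations -/

section Exponential

variable {n r : ℕ} {G : Type*} [TopologicalSpace G] [ChartedSpace (EuclideanSpace ℝ (Fin n)) G]
  [Group G]

theorem mulInvariantVectorField_sum_smul (X : Fin r → GroupLieAlgebra (𝓡 n) G)
    (c : Fin r → ℝ) (x : G) : mulInvariantVectorField (∑ j, c j • X j) x =
      ∑ j, c j • mulInvariantVectorField (X j) x := by
  have h := ContinuousLinearMap.map_smul_sum_smul
    (mfderiv (𝓡 n) (𝓡 n) (fun y : G ↦ x * y) 1 :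
      EuclideanSpace ℝ (Fin n) →L[ℝ] EuclideanSpace ℝ (Fin n)) 1 c X
  rw [one_smul, one_smul] at h
  exact h

theorem hasDerivAt_comp_isMIntegralCurve {f : G → ℝ} (hf : ContMDiff (𝓡 n) 𝓘(ℝ) ∞ f)
    {v : GroupLieAlgebra (𝓡 n) G} {γ : ℝ → G}
    (hγ : IsMIntegralCurve (I := 𝓡 n) γ (mulInvariantVectorField v)) (t : ℝ) :
    HasDerivAt (f ∘ γ)
      (mfderiv (𝓡 n) 𝓘(ℝ) f (γ t) (mulInvariantVectorField v (γ t)) : ℝ) t := by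
  have h1 := (hf.mdifferentiable (by simp) (γ t)).hasMFDerivAt.comp t (hγ t)
  let D : ℝ →L[ℝ] ℝ := (mfderiv (𝓡 n) 𝓘(ℝ) f (γ t)).comp
    ((1 : ℝ →L[ℝ] ℝ).smulRight (mulInvariantVectorField v (γ t)))
  have h2 : HasFDerivAt (f ∘ γ) D t := h1.hasFDerivAt
  have h3 : D 1 = mfderiv (𝓡 n) 𝓘(ℝ) f (γ t) (mulInvariantVectorField v (γ t)) :=
    congrArg (mfderiv (𝓡 n) 𝓘(ℝ) f (γ t)) (one_smul ℝ _)
  have h4 := h2.hasDerivAt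
  rw [h3] at h4
  exact h4

/-- The image of the integral curve of `v` is an integral curve of `w` through the identity, and
such curves are unique. -/
theorem IsLieExp.map {m : ℕ} {H : Type*} [TopologicalSpace H] [T2Space H]
    [ChartedSpace (EuclideanSpace ℝ (Fin m)) H] [Group H] [LieGroup (𝓡 m) ∞ H] {F : G →* H}
    (hF : ContMDiff (𝓡 n) (𝓡 m) ∞ F) {v : GroupLieAlgebra (𝓡 n) G} {w : GroupLieAlgebra (𝓡 m) H}
    (hvw : ∀ x, mfderiv (𝓡 n) (𝓡 m) F x (mulInvariantVectorField v x) =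
      mulInvariantVectorField w (F x)) {g : G} {h : H} (hg : IsLieExp v g) (hh : IsLieExp w h) :
    F g = h := by
  obtain ⟨γ, hγ0, hγ, rfl⟩ := hg
  obtain ⟨Γ, hΓ0, hΓ, rfl⟩ := hh
  have hI1 := IsManifold.of_le (I := 𝓡 m) (M := H) (m := 1) (n := ∞) ENat.LEInfty.out
  have h1 : IsMIntegralCurve (I := 𝓡 m) (F ∘ γ) (mulInvariantVectorField w) := by
    intro t
    have h2 := (hF.mdifferentiable (by simp) (γ t)).hasMFDerivAt.comp t (hγ t)
    refine h2.congr_mfderiv (ContinuousLinearMap.ext fun (c : ℝ) ↦ ?_)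
    change mfderiv (𝓡 n) (𝓡 m) F (γ t) (c • mulInvariantVectorField v (γ t)) =
      c • mulInvariantVectorField w (F (γ t))
    rw [map_smul, hvw]
  have h3 := isMIntegralCurve_Ioo_eq_of_contMDiff_boundaryless (t₀ := 0)
    (contMDiff_one_mulInvariantVectorField w) h1 hΓ (by simp [hγ0, hΓ0])
  exact congrFun h3 1

theorem IsLieExp.apply_eq {L : G → ℝ} (hL : ContMDiff (𝓡 n) 𝓘(ℝ) ∞ L) (hL1 : L 1 = 0)
    {v : GroupLieAlgebra (𝓡 n) G} {k : ℝ}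
    (hv : ∀ x, (mfderiv (𝓡 n) 𝓘(ℝ) L x (mulInvariantVectorField v x) : ℝ) = k) {g : G}
    (hg : IsLieExp v g) : L g = k := by
  obtain ⟨γ, hγ0, hγ, rfl⟩ := hg
  have hderiv : ∀ t, HasDerivAt (L ∘ γ) k t := by
    intro t
    have h := hasDerivAt_comp_isMIntegralCurve hL hγ t
    rw [hv] at h
    exact h
  have h3 := intervalIntegral.integral_eq_sub_of_hasDerivAt (a := 0) (b := 1)
    (fun s _ ↦ hderiv s) (by simp)
  simpa [hγ0, hL1] using h3.symm

/-- A smooth function whose horizontal derivative has norm at most one is 1-Lipschitz for the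
Carnot–Carathéodory distance. -/
theorem ofReal_abs_sub_le_ccEDist {X : Fin r → GroupLieAlgebra (𝓡 n) G} {L : G → ℝ}
    (hL : ContMDiff (𝓡 n) 𝓘(ℝ) ∞ L) {e : EuclideanSpace ℝ (Fin r)} (he : ‖e‖ ≤ 1)
    (hd : ∀ j x, (mfderiv (𝓡 n) 𝓘(ℝ) L x (mulInvariantVectorField (X j) x) : ℝ) = e j)
    (x y : G) : ENNReal.ofReal |L y - L x| ≤ ccEDist X x y := by
  refine le_of_forall_gt fun ℓ hℓ ↦ ?_
  obtain ⟨a, b, γ, u, hab, hγ, rfl, rfl, hlt⟩ := exists_isHorizontalCurve_of_ccEDist_lt hℓ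
  refine lt_of_le_of_lt (ENNReal.ofReal_le_ofReal ?_) hlt
  obtain ⟨-, h2⟩ := hγ.integral_eq_sub hab hL
  rw [← h2, ← Real.norm_eq_abs]
  refine intervalIntegral.norm_integral_le_of_norm_le hab (Eventually.of_forall fun t _ ↦ ?_)
    (intervalIntegrable_of_mem_Icc hγ.2.1.norm (left_mem_Icc.2 hab) (right_mem_Icc.2 hab))
  -- The derivative of `L` along the curve is `⟨e, u⟩`, so Cauchy–Schwarz bounds it by `‖u‖`.
  have h3 : ∑ j, u t j * (show ℝ from mfderiv (𝓡 n) 𝓘(ℝ) L (γ t)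
      (mulInvariantVectorField (X j) (γ t))) = inner ℝ e (u t) := by
    rw [PiLp.inner_apply]
    exact Finset.sum_congr rfl fun j _ ↦ congrArg (u t j * ·) (hd j (γ t))
  rw [h3]
  refine (norm_inner_le_norm e (u t)).trans ?_
  nlinarith [norm_nonneg (u t)]

variable [LieGroup (𝓡 n) ∞ G]

theorem continuous_mfderiv_mulInvariantVectorField {f : G → ℝ} (hf : ContMDiff (𝓡 n) 𝓘(ℝ) ∞ f)
    (v : GroupLieAlgebra (𝓡 n) G) :
    Continuous fun x ↦ (mfderiv (𝓡 n) 𝓘(ℝ) f x (mulInvariantVectorField v x) : ℝ) := by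
  have h1 := (hf.continuous_tangentMap (by simp)).comp
    (contMDiff_one_mulInvariantVectorField v).continuous
  have h2 := ((tangentBundleModelSpaceHomeomorph 𝓘(ℝ)).continuous.comp h1).snd
  exact h2

theorem isHorizontalCurve_of_isMIntegralCurve {X : Fin r → GroupLieAlgebra (𝓡 n) G}
    {c : EuclideanSpace ℝ (Fin r)} {γ : ℝ → G}
    (hγ : IsMIntegralCurve (I := 𝓡 n) γ (mulInvariantVectorField (∑ j, c j • X j))) (a b : ℝ) :
    IsHorizontalCurve X a b γ fun _ ↦ c := by
  have hcont : Continuous γ := continuous_iff_continuousAt.2 fun t ↦ (hγ t).continuousAt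
  refine ⟨⟨hcont.continuousOn, fun f hf ↦ ?_⟩, integrableOn_const (by simp), ?_⟩
  · have hderiv := hasDerivAt_comp_isMIntegralCurve hf hγ
    have hc := (continuous_mfderiv_mulInvariantVectorField hf (∑ j, c j • X j)).comp hcont
    refine absolutelyContinuousOnInterval_of_eq_add_integral (c := a) (k := f (γ a)) (by simp)
      (hc.intervalIntegrable a b) fun t _ ↦ ?_
    have h3 := intervalIntegral.integral_eq_sub_of_hasDerivAt (fun s _ ↦ hderiv s)
      (hc.intervalIntegrable a t)
    exact (sub_eq_iff_eq_add'.1 h3.symm)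
  · refine Eventually.of_forall fun t ↦ (hγ t).congr_mfderiv ?_
    rw [mulInvariantVectorField_sum_smul]

/-- Left translation gives integral curves from all points on one common time interval, which makes
the field complete. -/
theorem exists_isLieExp [T2Space G] (v : GroupLieAlgebra (𝓡 n) G) : ∃ g : G, IsLieExp v g := by
  have hv := contMDiff_one_mulInvariantVectorField (n := n) (G := G) v
  have hI1 := IsManifold.of_le (I := 𝓡 n) (M := G) (m := 1) (n := ∞) ENat.LEInfty.out
  obtain ⟨γ, hγ0, hγ⟩ := exists_isMIntegralCurveAt_of_contMDiffAt_boundaryless 0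
    (hv.contMDiffAt (x := 1))
  obtain ⟨ε, hε, hγε⟩ := isMIntegralCurveAt_iff'.1 hγ
  obtain ⟨Γ, hΓ0, hΓ⟩ := exists_isMIntegralCurve_of_isMIntegralCurveOn hv hε (fun x ↦ by
    refine ⟨fun t ↦ x * γ t, by simp [hγ0], fun t ht ↦ ?_⟩
    have h1 := hγε t (by rwa [Real.ball_eq_Ioo, zero_sub, zero_add])
    rw [Real.ball_eq_Ioo, zero_sub, zero_add] at h1
    have hcm : ContMDiff (𝓡 n) (𝓡 n) ∞ (fun y : G ↦ x * y) :=
      contMDiff_mul_left (I := 𝓡 n) (n := ∞) (a := x)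
    have h2 := (hcm.mdifferentiable (by simp) (γ t)).hasMFDerivAt.comp_hasMFDerivWithinAt t h1
    refine h2.congr_mfderiv (ContinuousLinearMap.ext fun (c : ℝ) ↦ ?_)
    change mfderiv (𝓡 n) (𝓡 n) (fun y : G ↦ x * y) (γ t)
      (c • mulInvariantVectorField v (γ t)) = c • mulInvariantVectorField v (x * γ t)
    rw [map_smul, mfderiv_mul_left_mulInvariantVectorField]) 1
  exact ⟨Γ 1, Γ, hΓ0, hΓ, rfl⟩

theorem ccEDist_one_le_of_isLieExp {X : Fin r → GroupLieAlgebra (𝓡 n) G}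
    {c : EuclideanSpace ℝ (Fin r)} {g : G} (hg : IsLieExp (∑ j, c j • X j) g) :
    ccEDist X 1 g ≤ ENNReal.ofReal ‖c‖ := by
  obtain ⟨γ, hγ0, hγ, rfl⟩ := hg
  have := ccEDist_le (isHorizontalCurve_of_isMIntegralCurve hγ 0 1) zero_le_one
  simpa [hγ0] using this

end Exponential

/-! ### Linear forms on the horizontal layer -/

section Stratification

variable {n s r : ℕ} {G : Type*} [TopologicalSpace G]
  [ChartedSpace (EuclideanSpace ℝ (Fin n)) G] [Group G]

namespace CarnotStratification

/-- A linear form on the first layer extends to the Lie algebra by zero on the other layers. -/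
theorem exists_linearForm (S : CarnotStratification (n := n) G s) (φ : S.layer 1 →ₗ[ℝ] ℝ) :
    ∃ θ : EuclideanSpace ℝ (Fin n) →L[ℝ] ℝ, (∀ x : S.layer 1, θ (x : GroupLieAlgebra (𝓡 n) G) = φ x) ∧
      ∀ i, i ≠ 1 → ∀ x ∈ S.layer i, θ x = 0 := by
  let e := LinearEquiv.ofBijective (DirectSum.coeLinearMap S.layer) S.isInternal
  let θ₀ : GroupLieAlgebra (𝓡 n) G →ₗ[ℝ] ℝ :=
    φ ∘ₗ (DirectSum.component ℝ ℕ (fun i ↦ S.layer i) 1) ∘ₗ (e.symm : _ →ₗ[ℝ] _)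
  have he : ∀ i (x : S.layer i), e.symm (x : GroupLieAlgebra (𝓡 n) G) =
      DirectSum.lof ℝ ℕ (fun i ↦ S.layer i) i x := by
    intro i x
    rw [LinearEquiv.symm_apply_eq]
    exact (DirectSum.coeLinearMap_lof S.layer i x).symm
  refine ⟨LinearMap.toContinuousLinearMap (E := EuclideanSpace ℝ (Fin n)) θ₀,
    fun x ↦ ?_, fun i hi x hx ↦ ?_⟩
  · change φ (DirectSum.component ℝ ℕ (fun i ↦ S.layer i) 1
      (e.symm (x : GroupLieAlgebra (𝓡 n) G))) = φ x
    rw [he, DirectSum.component.lof_self]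
  · change φ (DirectSum.component ℝ ℕ (fun i ↦ S.layer i) 1 (e.symm x)) = 0
    rw [he i ⟨x, hx⟩, DirectSum.component.of, dif_neg hi, map_zero]

variable [LieGroup (𝓡 n) ∞ G]

/-- Induction on `i` by the Jacobi identity `[[a, b], y] = [a, [b, y]] - [b, [a, y]]` with `a`
horizontal. -/
theorem lie_mem_layer (S : CarnotStratification (n := n) G s) {i j : ℕ} (hi : 1 ≤ i) (hj : 1 ≤ j)
    {x y : GroupLieAlgebra (𝓡 n) G} (hx : x ∈ S.layer i) (hy : y ∈ S.layer j) :
    ⁅x, y⁆ ∈ S.layer (i + j) := by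
  have := LieGroup.minSmoothness_three (n := n) (G := G)
  have hone : ∀ j, 1 ≤ j → ∀ a ∈ S.layer 1, ∀ b ∈ S.layer j, ⁅a, b⁆ ∈ S.layer (j + 1) := by
    intro j hj a ha b hb
    rw [S.layer_succ j hj]
    exact Submodule.subset_span ⟨a, ha, b, hb, rfl⟩
  induction i, hi using Nat.le_induction generalizing j x y with
  | base => rw [add_comm]; exact hone j hj x hx y hy
  | succ i hi ih =>
    rw [S.layer_succ i hi] at hx
    induction hx using Submodule.span_induction with
    | mem z hz =>
      obtain ⟨a, ha, b, hb, rfl⟩ := hz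
      rw [lie_lie]
      refine Submodule.sub_mem _ ?_ ?_
      · rw [add_right_comm]
        exact hone _ (by omega) a ha _ (ih hj hb hy)
      · rw [add_assoc, add_comm 1 j]
        exact ih (by omega) hb (hone j hj a ha y hy)
    | zero => rw [zero_lie]; exact Submodule.zero_mem _
    | add p q _ _ hp hq => rw [add_lie]; exact Submodule.add_mem _ hp hq
    | smul c p _ hp => rw [smul_lie]; exact Submodule.smul_mem _ c hp

/-- Brackets of layers of positive index lie in layers of index at least two, where `θ` vanishes;
the layer of index zero is trivial. -/
theorem linearForm_lie_eq_zero (S : CarnotStratification (n := n) G s)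
    {θ : EuclideanSpace ℝ (Fin n) →L[ℝ] ℝ} (hθ : ∀ i, i ≠ 1 → ∀ x ∈ S.layer i, θ x = 0)
    (v w : GroupLieAlgebra (𝓡 n) G) : θ (⁅v, w⁆ : GroupLieAlgebra (𝓡 n) G) = 0 := by
  have := LieGroup.minSmoothness_three (n := n) (G := G)
  have htop : ∀ v : GroupLieAlgebra (𝓡 n) G, v ∈ ⨆ i, S.layer i := fun v ↦ by
    rw [S.isInternal.submodule_iSup_eq_top]; trivial
  have hadd : ∀ a b : GroupLieAlgebra (𝓡 n) G, θ (a + b : GroupLieAlgebra (𝓡 n) G) = θ a + θ b :=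
    fun a b ↦ map_add θ a b
  have hz : θ (0 : GroupLieAlgebra (𝓡 n) G) = 0 := map_zero θ
  induction htop v using Submodule.iSup_induction' with
  | zero => rw [zero_lie]; exact hz
  | add a b _ _ ha hb => rw [add_lie, hadd, ha, hb, add_zero]
  | mem i x hx =>
    induction htop w using Submodule.iSup_induction' with
    | zero => rw [lie_zero]; exact hz
    | add a b _ _ ha hb => rw [lie_add, hadd, ha, hb, add_zero]
    | mem j y hy =>
      rcases Nat.eq_zero_or_pos i with rfl | hi
      · rw [S.layer_zero, Submodule.mem_bot] at hx
        rw [hx, zero_lie]; exact hz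
      rcases Nat.eq_zero_or_pos j with rfl | hj
      · rw [S.layer_zero, Submodule.mem_bot] at hy
        rw [hy, lie_zero]; exact hz
      exact hθ (i + j) (by omega) _ (S.lie_mem_layer hi hj hx hy)

/-- Every linear form on the first layer is the horizontal derivative of a smooth `G`-linear
function. -/
theorem exists_isGLinear [SimplyConnectedSpace G] (S : CarnotStratification (n := n) G s)
    (X : Module.Basis (Fin r) ℝ (S.layer 1)) (e : EuclideanSpace ℝ (Fin r)) :
    ∃ L : G → ℝ, ContMDiff (𝓡 n) 𝓘(ℝ) ∞ L ∧ S.IsGLinear L ∧ ∀ j x,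
      (mfderiv (𝓡 n) 𝓘(ℝ) L x (mulInvariantVectorField (S.frame X j) x) : ℝ) = e j := by
  obtain ⟨θ, hθ1, hθ⟩ := S.exists_linearForm (∑ j, e j • X.coord j)
  obtain ⟨L, hL, hmul, hd⟩ := exists_hom_of_linearForm (S.linearForm_lie_eq_zero hθ)
  have hL1 : L 1 = 0 := by simpa using hmul 1 1
  refine ⟨L, hL, ⟨hmul, fun c hc x y hxy ↦ ?_⟩, fun j x ↦ ?_⟩
  -- On an exponential `L` is the value of `θ`, which only sees the first layer, and there the
  -- dilation is multiplication by `c`.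
  · obtain ⟨v, hv, hx, hy⟩ := hxy
    rw [hx.apply_eq hL hL1 fun z ↦ hd z _, hy.apply_eq hL hL1 fun z ↦ hd z _]
    have h1 : ∀ w : ℕ → EuclideanSpace ℝ (Fin n),
        θ (∑ i ∈ Finset.range (s + 1), w i) = ∑ i ∈ Finset.range (s + 1), θ (w i) := fun w ↦
      map_sum θ _ _
    refine (h1 _).trans (Eq.trans ?_ (congrArg (c * ·) (h1 v)).symm)
    rw [Finset.mul_sum]
    refine Finset.sum_congr rfl fun i _ ↦ ?_
    have h2 : θ (c ^ i • v i) = c ^ i * θ (v i) := map_smul θ (c ^ i) (v i)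
    refine h2.trans ?_
    by_cases hi : i = 1
    · rw [hi, pow_one]
    · rw [hθ i hi _ (hv i), mul_zero, mul_zero]
  · rw [hd]
    refine (hθ1 (X j)).trans ?_
    simp [Finsupp.single_apply]

end CarnotStratification

end Stratification

theorem map_inv_of_map_mul {K : Type*} [Group K] {f : K → ℝ}
    (hf : ∀ x y, f (x * y) = f x + f y) (x : K) : f x⁻¹ = -f x := by
  have h1 := hf x x⁻¹
  have h2 := hf 1 1
  rw [mul_inv_cancel] at h1
  rw [mul_one] at h2
  linarith

/-! ### Calibrated distance to the identity -/

section Distance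

variable {n r : ℕ} {G : Type*} [TopologicalSpace G] [ChartedSpace (EuclideanSpace ℝ (Fin n)) G]
  [Group G] {X : Fin r → GroupLieAlgebra (𝓡 n) G} {L : G → ℝ} {e c : EuclideanSpace ℝ (Fin r)}

/-- The lower half of the calibration. Finiteness matters because `toReal` sends `⊤` to zero. -/
theorem le_ccDist_one (hL : ContMDiff (𝓡 n) 𝓘(ℝ) ∞ L) (hL1 : L 1 = 0) (he : ‖e‖ ≤ 1)
    (hd : ∀ j x, (mfderiv (𝓡 n) 𝓘(ℝ) L x (mulInvariantVectorField (X j) x) : ℝ) = e j)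
    {x : G} (hx : ccEDist X x 1 ≠ ⊤) : L x ≤ ccDist X x 1 := by
  have h := (ENNReal.ofReal_le_iff_le_toReal hx).1 (ofReal_abs_sub_le_ccEDist hL he hd x 1)
  rw [hL1, zero_sub, abs_neg] at h
  exact (le_abs_self _).trans h

theorem apply_eq_inner_of_isLieExp (hL : ContMDiff (𝓡 n) 𝓘(ℝ) ∞ L) (hL1 : L 1 = 0)
    (hd : ∀ j x, (mfderiv (𝓡 n) 𝓘(ℝ) L x (mulInvariantVectorField (X j) x) : ℝ) = e j)
    {g : G} (hg : IsLieExp (∑ j, c j • X j) g) : L g = inner ℝ e c := by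
  refine hg.apply_eq hL hL1 fun x ↦ ?_
  rw [mulInvariantVectorField_sum_smul, PiLp.inner_apply]
  refine (map_sum (mfderiv (𝓡 n) 𝓘(ℝ) L x) _ _).trans (Finset.sum_congr rfl fun j _ ↦ ?_)
  exact (map_smul (mfderiv (𝓡 n) 𝓘(ℝ) L x) (c j) _).trans (congrArg (c j * ·) (hd j x))

variable [LieGroup (𝓡 n) ∞ G]

/-- In a horizontal direction the distance to the identity is realized by the one-parameter
subgroup, as soon as some smooth function is calibrated by that direction. -/
theorem ccDist_one_eq_of_isLieExp (hL : ContMDiff (𝓡 n) 𝓘(ℝ) ∞ L) (hL1 : L 1 = 0) (he : ‖e‖ ≤ 1)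
    (hd : ∀ j x, (mfderiv (𝓡 n) 𝓘(ℝ) L x (mulInvariantVectorField (X j) x) : ℝ) = e j)
    (hec : inner ℝ e c = ‖c‖) {g : G} (hg : IsLieExp (∑ j, c j • X j) g) :
    ccEDist X g 1 ≠ ⊤ ∧ ccDist X g 1 = ‖c‖ := by
  have h1 := ccEDist_one_le_of_isLieExp hg
  rw [ccEDist_comm] at h1
  have h2 : ccEDist X g 1 ≠ ⊤ := (h1.trans_lt ENNReal.ofReal_lt_top).ne
  refine ⟨h2, le_antisymm ?_ ?_⟩
  · exact ENNReal.toReal_le_of_le_ofReal (norm_nonneg c) h1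
  · rw [← hec, ← apply_eq_inner_of_isLieExp hL hL1 hd hg]
    exact le_ccDist_one hL hL1 he hd h2

/-- By left invariance and symmetry both sides are the distance from the identity to `x`. This
permits reflecting a point through `g` without changing its distance to `g`. -/
theorem ccEDist_self_mul_inv (g x : G) : ccEDist X g (g * x⁻¹) = ccEDist X g (g * x) := by
  calc ccEDist X g (g * x⁻¹) = ccEDist X (g * 1) (g * x⁻¹) := by rw [mul_one]
    _ = ccEDist X (x * 1) (x * x⁻¹) := by rw [ccEDist_mul_left, ccEDist_mul_left]
    _ = ccEDist X (g * 1) (g * x) := by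
      rw [mul_one, mul_inv_cancel, ccEDist_comm, ccEDist_mul_left]
    _ = ccEDist X g (g * x) := by rw [mul_one]

end Distance

/-- Let `G` and `H` be Carnot groups, `X` and `Y` bases of their horizontal layers with the same
number of elements, and `F : G → H` a Lie group homomorphism with `F_* X_j = Y_j` for all `j`.
If the Carnot–Carathéodory distance of `G` (for the basis `X`) is differentiable in horizontal
directions, then so is the Carnot–Carathéodory distance of `H` (for the basis `Y`). -/
theorem proposition6
    {m n s t r : ℕ}
    {G : Type*} [TopologicalSpace G] [T2Space G] [ChartedSpace (EuclideanSpace ℝ (Fin m)) G]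
    [Group G] [LieGroup (𝓡 m) ∞ G] [SimplyConnectedSpace G]
    {H : Type*} [TopologicalSpace H] [T2Space H] [ChartedSpace (EuclideanSpace ℝ (Fin n)) H]
    [Group H] [LieGroup (𝓡 n) ∞ H] [SimplyConnectedSpace H]
    (V : CarnotStratification (n := m) G s) (W : CarnotStratification (n := n) H t)
    (X : Module.Basis (Fin r) ℝ (V.layer 1)) (Y : Module.Basis (Fin r) ℝ (W.layer 1))
    (F : G →* H) (hF : ContMDiff (𝓡 m) (𝓡 n) ∞ F)
    (hXY : ∀ (j : Fin r) (x : G),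
      mfderiv (𝓡 m) (𝓡 n) F x (mulInvariantVectorField (V.frame X j) x) =
        mulInvariantVectorField (W.frame Y j) (F x))
    (hG : V.CCDistDifferentiableHorizontally X) :
    W.CCDistDifferentiableHorizontally Y := by
  intro E hE hE0 u hu
  let c : EuclideanSpace ℝ (Fin r) := WithLp.toLp 2 fun j ↦ Y.repr ⟨E, hE⟩ j
  have hc : ∑ j, c j • W.frame Y j = E := by
    have h := congrArg (W.layer 1).subtype (Y.sum_repr ⟨E, hE⟩)
    rw [map_sum] at h
    simp only [map_smul] at h
    exact h
  have hc0 : c ≠ 0 := by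
    intro h
    refine hE0 (hc.symm.trans (Finset.sum_eq_zero fun j _ ↦ ?_))
    rw [h, PiLp.zero_apply, zero_smul]
  -- The unit vector `c / ‖c‖` gives equality in Cauchy–Schwarz, so `L` calibrates the direction of
  -- `E`.
  obtain ⟨e, he, hec⟩ : ∃ e : EuclideanSpace ℝ (Fin r), ‖e‖ ≤ 1 ∧ inner ℝ e c = ‖c‖ := by
    refine ⟨‖c‖⁻¹ • c, (norm_smul_inv_norm (𝕜 := ℝ) hc0).le, ?_⟩
    rw [real_inner_smul_left, real_inner_self_eq_norm_sq, pow_two,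
      inv_mul_cancel_left₀ (norm_ne_zero_iff.2 hc0)]
  obtain ⟨L, hL, hLin, hLd⟩ := W.exists_isGLinear Y e
  have hL1 : L 1 = 0 := by simpa using hLin.1 1 1
  have hLF : ContMDiff (𝓡 m) 𝓘(ℝ) ∞ (L ∘ F) := hL.comp hF
  have hLF1 : (L ∘ F) 1 = 0 := by simp [hL1]
  have hLFd : ∀ j x, (mfderiv (𝓡 m) 𝓘(ℝ) (L ∘ F) x
      (mulInvariantVectorField (V.frame X j) x) : ℝ) = e j := by
    intro j x
    rw [mfderiv_comp x (hL.mdifferentiable (by simp) (F x)) (hF.mdifferentiable (by simp) x)]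
    refine (congrArg (mfderiv (𝓡 n) 𝓘(ℝ) L (F x)) (hXY j x)).trans (hLd j (F x))
  -- a horizontal lift of `u`
  have hE'mem : ∑ j, c j • V.frame X j ∈ V.layer 1 :=
    Submodule.sum_mem _ fun j _ ↦ Submodule.smul_mem _ _ (X j).2
  have hE'0 : ∑ j, c j • V.frame X j ≠ 0 := by
    intro h
    have h1 : ∑ j, c j • X j = 0 := by
      apply (V.layer 1).injective_subtype
      rw [map_sum, map_zero]
      simp only [map_smul]
      exact h
    exact hc0 (PiLp.ext fun j ↦ Fintype.linearIndependent_iff.1 X.linearIndependent _ h1 j)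
  obtain ⟨u', hu'⟩ := exists_isLieExp (∑ j, c j • V.frame X j)
  have huE : IsLieExp (∑ j, c j • W.frame Y j) u := by rwa [hc]
  have hFu : F u' = u := hu'.map hF (fun x ↦ by
    rw [mulInvariantVectorField_sum_smul, mulInvariantVectorField_sum_smul]
    simp only [map_sum, map_smul, hXY]) huE
  obtain ⟨huT, huN⟩ := ccDist_one_eq_of_isLieExp hL hL1 he hLd hec huE
  obtain ⟨hu'T, hu'N⟩ := ccDist_one_eq_of_isLieExp hLF hLF1 he hLFd hec hu'
  have hLu : L u = ‖c‖ := (apply_eq_inner_of_isLieExp hL hL1 hLd huE).trans hec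
  -- The differential is the calibration itself. Differentiability in `G` is used twice, at `z` and
  -- at its reflection, hence with `ε / 2`.
  refine ⟨L, hLin, fun ε hε ↦ ?_⟩
  obtain ⟨P, hP, hPd⟩ := hG _ hE'mem hE'0 u' hu'
  obtain ⟨δ, hδ, hPδ⟩ := hPd (ε / 2) (by positivity)
  refine ⟨δ, hδ, fun y hy ↦ ?_⟩
  have hLy : ∀ y, L y = ‖c‖ + L (u⁻¹ * y) := fun y ↦ by rw [← hLu, ← hLin.1, mul_inv_cancel_left]
  have hyT : ccEDist (W.frame Y) u y ≠ ⊤ := (hy.trans ENNReal.ofReal_lt_top).ne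
  have hy1 : ccEDist (W.frame Y) y 1 ≠ ⊤ := by
    refine ne_top_of_le_ne_top (ENNReal.add_ne_top.2 ⟨hyT, huT⟩)
      ((ccEDist_triangle y u 1).trans_eq (by rw [ccEDist_comm y u]))
  have hlow := le_ccDist_one hL hL1 he hLd hy1
  simp only [huN]
  have hD0 : 0 ≤ ccDist (W.frame Y) u y := ENNReal.toReal_nonneg
  -- The lower bound is the calibration inequality `L y ≤ d(y)`; only the upper bound remains.
  rw [abs_of_nonneg (by linarith [hLy y])]
  refine le_of_forall_pos_le_add fun η hη ↦ ?_
  -- a lift of `y` almost realizing the distance to `u`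
  have hℓ : ccEDist (W.frame Y) (F u') y <
      min (ENNReal.ofReal δ) (ENNReal.ofReal (ccDist (W.frame Y) u y + η / ε)) := by
    rw [hFu]
    refine lt_min hy ?_
    rw [ENNReal.lt_ofReal_iff_toReal_lt hyT]
    exact lt_add_of_pos_right _ (by positivity)
  obtain ⟨z, rfl, hz⟩ := exists_lift_ccEDist hF hXY u' hℓ
  obtain ⟨hzδ, hzη⟩ := lt_min_iff.1 hz
  have hzT : ccEDist (V.frame X) u' z ≠ ⊤ := (hzδ.trans ENNReal.ofReal_lt_top).ne
  rw [ENNReal.lt_ofReal_iff_toReal_lt hzT] at hzη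
  change ccDist (V.frame X) u' z < _ at hzη
  have h1 := hPδ z hzδ
  -- At the reflection of `z` through `u'` the increments of `P` and `L ∘ F` change sign, so the
  -- calibration there bounds `P` from above at `z`.
  have hsymm : ccEDist (V.frame X) u' (u' * (u'⁻¹ * z)⁻¹) = ccEDist (V.frame X) u' z := by
    rw [ccEDist_self_mul_inv, mul_inv_cancel_left]
  have h2 := hPδ (u' * (u'⁻¹ * z)⁻¹) (by rwa [hsymm])
  have hsymm' : ccDist (V.frame X) u' (u' * (u'⁻¹ * z)⁻¹) = ccDist (V.frame X) u' z :=
    congrArg ENNReal.toReal hsymm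
  have hT1 : ∀ w, ccEDist (V.frame X) u' w ≠ ⊤ → ccEDist (V.frame X) w 1 ≠ ⊤ := fun w hw ↦
    ne_top_of_le_ne_top (ENNReal.add_ne_top.2 ⟨hw, hu'T⟩)
      ((ccEDist_triangle w u' 1).trans_eq (by rw [ccEDist_comm w u']))
  have hlow' : L (F (u' * (u'⁻¹ * z)⁻¹)) ≤ ccDist (V.frame X) (u' * (u'⁻¹ * z)⁻¹) 1 :=
    le_ccDist_one hLF hLF1 he hLFd (hT1 _ (by rwa [hsymm]))
  have hup : ccDist (W.frame Y) (F z) 1 ≤ ccDist (V.frame X) z 1 := by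
    have h3 := ccEDist_map_le hF hXY z 1
    rw [map_one] at h3
    exact ENNReal.toReal_mono (hT1 z hzT) h3
  have hPinv := map_inv_of_map_mul hP.1 (u'⁻¹ * z)
  have hLinv := map_inv_of_map_mul hLin.1 (u⁻¹ * F z)
  rw [map_mul, map_inv, map_mul, map_inv, hFu, hLy, inv_mul_cancel_left, hLinv] at hlow'
  rw [inv_mul_cancel_left, hPinv, hsymm'] at h2
  simp only [hu'N] at h1 h2
  -- `h1'` bounds `d(z)` above by means of `P`; `h2'` and `hlow'` bound `P` by `L`. The two errors
  -- add up to `ε * d(u', z)`, and the excess `η / ε` of the lift costs `η`.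
  have h1' := (abs_le.1 h1).2
  have h2' := (abs_le.1 h2).2
  have h5 : ε * ccDist (V.frame X) u' z ≤ ε * (ccDist (W.frame Y) u (F z) + η / ε) :=
    mul_le_mul_of_nonneg_left hzη.le hε.le
  have h6 : ε * (η / ε) = η := mul_div_cancel₀ η hε.ne'
  rw [mul_add, h6] at h5
  linarith
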